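/- **Model (independent failures).** There are $n\ge 2$ asynchronous deterministic processes. They communicate through atomic non-volatile base objects, each of which supports read, write and a set of deterministic read-modify-write primitives; local variables are volatile. An implementation $I$ of an object $O$ (with a total deterministic sequential specification) gives, for each process and each operation instance $Op$ of $O$, the code of $Op$ and the code of its recovery procedure $Op.\mathrm{RECOVER}$. A process has at most one pending operation. It may crash at any point while an operation $Op$ is pending, independently of the others; a crash sets its local state to an arbitrary value and leaves the base objects unchanged. The only step of a crashed process $p$ is a recovery step, which starts $Op.\mathrm{RECOVER}$ with the same arguments as $Op$; $Op$ and $Op.\mathrm{RECOVER}$ also have access to a non-volatile sequence number $SEQ_p$, which is incremented at each invocation by $p$. A history is the sequence of invocation, response, crash and recovery steps of an execution. $I$ is *recoverable* if each of its finite histories $H$ satisfies nesting-safe recoverable linearizability (NRL): in $H$ every crash step of a process is its last step or is followed, as the next step of that process, by a recovery step, and the history $N(H)$ obtained by deleting crash and recovery steps is well-formed and linearizable with respect to $O$. **Lock-freedom.** $M$ and $M.\mathrm{RECOVER}$ are lock-free in $I$ if in every infinite execution, for every time $T$ and every set $P$ of processes that are executing $M$ or $M.\mathrm{RECOVER}$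 at time $T$: if the processes in $P$ together take infinitely many steps after $T$ and none of them crashes after $T$, then some process completes its operation after $T$. (Processes outside $P$ may take steps and crash arbitrarily often.) **Distinguishable operation.** An operation $M:\mathrm{VAL}\to\mathrm{RET}$ of $O$ is distinguishable if there are a finite sequential base history $\alpha_{base}$ of $O$, values $x,y\in\mathrm{VAL}$ and $z\in\mathrm{RET}$ such that, if $M(x)$ and $M(y)$ are applied sequentially, in either order, right after $\alpha_{base}$, then the first one returns $z$ and the second one does not. **Interfering primitives.** A set of primitives is interfering if for any two of them, $f$ and $g$, any base object that supports both, and any state $S$ of it, one of the following holds for the resulting states: $f$ and $g$ commute, $g(f(S))=f(g(S))$; or one overwrites the other, $g(f(S))=g(S)$ or $f(g(S))=f(S)$. **Theorem.** Let $M$ be a distinguishable operation of $O$ and let $n\ge 2$. There is no recoverable implementation $I$ of $O$ from read, write and a set of interfering primitives in the independent failures model such that both $M$ and $M.\mathrm{RECOVER}$ are lock-free. Here an implementation is only required, for the operations of $O$ other than $M$ (if there are any), to complete each of them when it is executed alone, that is, in a crash-free execution in which no other process has a pending operation and only the executing process takes steps. In particular, for a swap object over a set of at least two values and $n\ge2$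 processes, there is no recoverable implementation of SWAP from read, write and primitive swap (on base objects with arbitrary value domains) in which SWAP and SWAP.RECOVER are lock-free. -/

import Mathlib

universe u v w a b c d e f

/-! ### Histories, sequential objects, linearizability and NRL -/

/-- The steps that make up a history of one implemented object, for processes `Fin n`:
invocation, (matching) response, crash and recovery steps. -/
inductive Event (n : ℕ) (Op : Type u) (Ret : Type v) : Type (max u v)
  | invoke (p : Fin n) (op : Op)
  | respond (p : Fin n) (op : Op) (r : Ret)
  | crash (p : Fin n)
  | recover (p : Fin n)

namespace Event

variable {n : ℕ} {Op : Type u} {Ret : Type v}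

/-- The process that takes the step. -/
def proc : Event n Op Ret → Fin n
  | invoke p _ => p
  | respond p _ _ => p
  | crash p => p
  | recover p => p

/-- Is the step an invocation by `p`? -/
def isInvokeOf (p : Fin n) : Event n Op Ret → Bool
  | invoke q _ => decide (q = p)
  | _ => false

/-- Is the step a response to `p`? -/
def isRespondOf (p : Fin n) : Event n Op Ret → Bool
  | respond q _ _ => decide (q = p)
  | _ => false

/-- Is the step neither a crash step nor a recovery step? -/
def isCrashFree : Event n Op Ret → Bool
  | crash _ => false
  | recover _ => false
  | _ => true

end Event

/-- A (total, deterministic) sequential object with operation instances `Op` (an operation together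
with its arguments) and return values in `Ret`. Its legal sequential histories are those that are
produced by `apply` from `init`. -/
structure SeqObject (Op : Type u) (Ret : Type v) where
  State : Type w
  init : State
  apply : State → Op → State × Ret

namespace SeqObject

variable {Op : Type u} {Ret : Type v} (O : SeqObject.{u, v, w} Op Ret)

/-- The state reached from `s` by applying a list of operations sequentially. -/
def runOps (s : O.State) (l : List Op) : O.State :=
  l.foldl (fun s op => (O.apply s op).1) s

/-- A complete sequential history, given as a list of operations with process and return value,
is legal from state `s`. -/
def LegalFrom {n : ℕ} : O.State → List (Fin n × Op × Ret) → Prop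
  | _, [] => True
  | s, (_, op, r) :: l => (O.apply s op).2 = r ∧ LegalFrom (O.apply s op).1 l

/-- The operation `M` (with argument type `Val`) is distinguishable: there are a base history
(the sequential execution of `base`), arguments `x`, `y` and a value `z` such that if `M x` and
`M y` are applied sequentially, in either order, right after the base history, then the first one,
and only the first one, returns `z`. -/
def Distinguishable {Val : Type a} (M : Val → Op) : Prop :=
  ∃ (base : List Op) (x y : Val) (z : Ret),
    let s := O.runOps O.init base
    ((O.apply s (M x)).2 = z ∧ (O.apply (O.apply s (M x)).1 (M y)).2 ≠ z) ∧
    ((O.apply s (M y)).2 = z ∧ (O.apply (O.apply s (M y)).1 (M x)).2 ≠ z)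

end SeqObject

namespace History

variable {n : ℕ} {Op : Type u} {Ret : Type v}

/-- The sub-history of the steps of `p`. -/
def proj (p : Fin n) (H : List (Event n Op Ret)) : List (Event n Op Ret) :=
  H.filter (fun e => decide (e.proc = p))

/-- `N(H)`: the crash and recovery steps are removed. -/
def removeCrashes (H : List (Event n Op Ret)) : List (Event n Op Ret) :=
  H.filter Event.isCrashFree

/-- Alternating matching invocation and response steps, starting with an invocation
(possibly ending with a pending invocation). -/
def Alternating : List (Event n Op Ret) → Prop
  | [] => True
  | [.invoke _ _] => True
  | .invoke p op :: .respond q op' _ :: l => p = q ∧ op = op' ∧ Alternating l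
  | _ => False

/-- Well-formedness of a crash-free history (of a single object). -/
def WellFormed (H : List (Event n Op Ret)) : Prop :=
  ∀ p : Fin n, Alternating (proj p H)

/-- Recoverable well-formedness: every crash step of `p` is `p`'s last step or is followed
in `H|p` by a recovery step of `p`, and `N(H)` is well-formed. -/
def RecoverableWellFormed (H : List (Event n Op Ret)) : Prop :=
  (∀ (p : Fin n) (l₁ l₂ : List (Event n Op Ret)),
    proj p H = l₁ ++ Event.crash p :: l₂ → l₂ = [] ∨ ∃ l₃, l₂ = Event.recover p :: l₃) ∧
  WellFormed (removeCrashes H)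

/-- Remove all pending invocations. (In a well-formed history an invocation by `p` is pending
iff no response to `p` comes later.) -/
def dropPending : List (Event n Op Ret) → List (Event n Op Ret)
  | [] => []
  | .invoke p op :: l =>
      if l.any (Event.isRespondOf p) then .invoke p op :: dropPending l else dropPending l
  | e :: l => e :: dropPending l

/-- `H'` is a completion of `H`: append matching responses `R` to some of the pending operations,
and remove the remaining pending operations. -/
def IsCompletion (H H' : List (Event n Op Ret)) : Prop :=
  ∃ R : List (Event n Op Ret),
    (∀ e ∈ R, ∃ p op r, e = Event.respond p op r) ∧ WellFormed (H ++ R) ∧ H' = dropPending (H ++ R)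

/-- The sequential history in which the listed operations are executed one after the other. -/
def sequential (L : List (Fin n × Op × Ret)) : List (Event n Op Ret) :=
  L.flatMap (fun t => [Event.invoke t.1 t.2.1, Event.respond t.1 t.2.1 t.2.2])

/-- The pair `(p, k)` names the operation of `p` that has number `k` (from `0`) among the
operations of `p`. It appears in `H` if it is invoked there. -/
def Appears (H : List (Event n Op Ret)) (o : Fin n × ℕ) : Prop :=
  o.2 < H.countP (Event.isInvokeOf o.1)

/-- The happens-before order: the response step of `o₁` precedes the invocation step of `o₂`. -/
def HappensBefore (H : List (Event n Op Ret)) (o₁ o₂ : Fin n × ℕ) : Prop :=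
  ∃ (i j : ℕ) (e₁ e₂ : Event n Op Ret), i < j ∧
    H[i]? = some e₁ ∧ e₁.isRespondOf o₁.1 = true ∧
      (H.take i).countP (Event.isRespondOf o₁.1) = o₁.2 ∧
    H[j]? = some e₂ ∧ e₂.isInvokeOf o₂.1 = true ∧
      (H.take j).countP (Event.isInvokeOf o₂.1) = o₂.2

/-- Linearizability of a finite crash-free history. -/
def Linearizable (O : SeqObject.{u, v, w} Op Ret) (H : List (Event n Op Ret)) : Prop :=
  ∃ (H' : List (Event n Op Ret)) (L : List (Fin n × Op × Ret)),
    IsCompletion H H' ∧ O.LegalFrom O.init L ∧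
    (∀ p, proj p H' = proj p (sequential L)) ∧
    ∀ o₁ o₂, HappensBefore H o₁ o₂ → Appears (sequential L) o₁ → Appears (sequential L) o₂ →
      HappensBefore (sequential L) o₁ o₂

/-- Nesting-safe recoverable linearizability of a finite history. -/
def NRL (O : SeqObject.{u, v, w} Op Ret) (H : List (Event n Op Ret)) : Prop :=
  RecoverableWellFormed H ∧ Linearizable O (removeCrashes H)

end History

/-! ### Base objects and primitives -/

/-- A collection of non-volatile base objects. Every base object `o` supports read and write, and
the read-modify-write primitives `Prim o` (a primitive together with its arguments). -/
structure BaseSystem where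
  Obj : Type a
  St : Obj → Type b
  Prim : Obj → Type c
  Resp : (o : Obj) → Prim o → Type d
  apply : (o : Obj) → (f : Prim o) → St o → St o × Resp o f

namespace BaseSystem

/-- The effect of a primitive on the state of a base object. -/
def effect (B : BaseSystem.{a, b, c, d}) (o : B.Obj) (f : B.Prim o) (s : B.St o) : B.St o :=
  (B.apply o f s).1

/-- The primitives are interfering: for any two of them, in every state of an object that supports
both, they commute or one of them overwrites the other one. -/
def Interfering (B : BaseSystem.{a, b, c, d}) : Prop :=
  ∀ (o : B.Obj) (f g : B.Prim o) (s : B.St o),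
    B.effect o g (B.effect o f s) = B.effect o f (B.effect o g s) ∨
    B.effect o g (B.effect o f s) = B.effect o g s ∨
    B.effect o f (B.effect o g s) = B.effect o f s

end BaseSystem

/-- The next step of a process inside an operation or its recovery procedure, with the local state
that results (as a function of the response of the primitive). -/
inductive Instr (B : BaseSystem.{a, b, c, d}) (Local : Type e) (Ret : Type v) :
    Type (max a b c d e v)
  | read (o : B.Obj) (next : B.St o → Local)
  | write (o : B.Obj) (val : B.St o) (next : Local)
  | prim (o : B.Obj) (f : B.Prim o) (next : B.Resp o f → Local)
  | ret (r : Ret) (next : Local)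

/-! ### Implementations and their executions in the independent failures model -/

/-- An implementation for the processes `Fin n` of operations `Op` with return values in `Ret`,
from the base objects `B`. `start p op k σ` is the local state in which `p` begins to execute `op`,
and `recovery p op k σ` the one in which `p` begins to execute the recovery procedure of `op`, where
`k` is the value of the non-volatile sequence number `SEQ_p` and `σ` is the local state of `p` just
before. -/
structure Implementation (B : BaseSystem.{a, b, c, d}) (n : ℕ) (Op : Type u) (Ret : Type v) where
  Local : Type e
  initMem : (o : B.Obj) → B.St o
  initLocal : Fin n → Local
  start : Fin n → Op → ℕ → Local → Local
  recovery : Fin n → Op → ℕ → Local → Local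
  code : Fin n → Local → Instr B Local Ret

/-- A process is idle (no pending operation), executes a pending operation `op` or its recovery
procedure, or has crashed while `op` was pending and has not recovered yet. -/
inductive Status (Op : Type u) (Local : Type e) : Type (max u e)
  | idle (σ : Local)
  | running (op : Op) (σ : Local)
  | crashed (op : Op) (σ : Local)

/-- A step of an execution: a step of the history or the application of a read, a write or another
primitive to a base object by process `p`. -/
inductive Label (n : ℕ) (Op : Type u) (Ret : Type v) : Type (max u v)
  | event (ev : Event n Op Ret)
  | access (p : Fin n)

namespace Label

variable {n : ℕ} {Op : Type u} {Ret : Type v}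

/-- The process that takes the step. -/
def proc : Label n Op Ret → Fin n
  | event ev => ev.proc
  | access p => p

/-- The step of the history, if any. -/
def toEvent? : Label n Op Ret → Option (Event n Op Ret)
  | event ev => some ev
  | access _ => none

end Label

namespace Implementation

variable {B : BaseSystem.{a, b, c, d}} {n : ℕ} {Op : Type u} {Ret : Type v}
  (I : Implementation.{u, v, a, b, c, d, e} B n Op Ret)

/-- A configuration: the base objects, the processes and the sequence numbers `SEQ_p`. -/
structure Config where
  mem : (o : B.Obj) → B.St o
  status : Fin n → Status Op I.Local
  seq : Fin n → ℕ

/-- The initial configuration. -/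
def initial : I.Config where
  mem := I.initMem
  status := fun p => .idle (I.initLocal p)
  seq := fun _ => 0

namespace Config

variable {I}

/-- Change the status of `p`. -/
def setStatus (C : I.Config) (p : Fin n) (s : Status Op I.Local) : I.Config :=
  { C with status := Function.update C.status p s }

open Classical in
/-- Change the state of the base object `o`. -/
noncomputable def setMem (C : I.Config) (o : B.Obj) (s : B.St o) : I.Config :=
  { C with mem := Function.update C.mem o s }

/-- Increment the sequence number of `p`. -/
def incSeq (C : I.Config) (p : Fin n) : I.Config :=
  { C with seq := Function.update C.seq p (C.seq p + 1) }

end Config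

/-- The steps of the independent failures model. A crash sets the local state of the process to an
arbitrary value `σ'` and does not affect anything else; the only step of the process that can
follow is the recovery step. -/
inductive Step : I.Config → Label n Op Ret → I.Config → Prop
  | invoke (C : I.Config) (p : Fin n) (op : Op) (σ : I.Local) (h : C.status p = .idle σ) :
      Step C (.event (.invoke p op))
        ((C.incSeq p).setStatus p (.running op (I.start p op (C.seq p + 1) σ)))
  | read (C : I.Config) (p : Fin n) (op : Op) (σ : I.Local) (h : C.status p = .running op σ)
      (o : B.Obj) (next : B.St o → I.Local) (hc : I.code p σ = .read o next) :
      Step C (.access p) (C.setStatus p (.running op (next (C.mem o))))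
  | write (C : I.Config) (p : Fin n) (op : Op) (σ : I.Local) (h : C.status p = .running op σ)
      (o : B.Obj) (val : B.St o) (next : I.Local) (hc : I.code p σ = .write o val next) :
      Step C (.access p) ((C.setMem o val).setStatus p (.running op next))
  | prim (C : I.Config) (p : Fin n) (op : Op) (σ : I.Local) (h : C.status p = .running op σ)
      (o : B.Obj) (f : B.Prim o) (next : B.Resp o f → I.Local) (hc : I.code p σ = .prim o f next) :
      Step C (.access p) ((C.setMem o (B.apply o f (C.mem o)).1).setStatus p
        (.running op (next (B.apply o f (C.mem o)).2)))
  | respond (C : I.Config) (p : Fin n) (op : Op) (σ : I.Local) (h : C.status p = .running op σ)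
      (r : Ret) (next : I.Local) (hc : I.code p σ = .ret r next) :
      Step C (.event (.respond p op r)) (C.setStatus p (.idle next))
  | crash (C : I.Config) (p : Fin n) (op : Op) (σ : I.Local) (h : C.status p = .running op σ)
      (σ' : I.Local) :
      Step C (.event (.crash p)) (C.setStatus p (.crashed op σ'))
  | recover (C : I.Config) (p : Fin n) (op : Op) (σ : I.Local) (h : C.status p = .crashed op σ) :
      Step C (.event (.recover p)) (C.setStatus p (.running op (I.recovery p op (C.seq p) σ)))

/-- `I.Reaches l C`: there is a finite execution from the initial configuration with the steps `l`
that ends in the configuration `C`. -/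
inductive Reaches : List (Label n Op Ret) → I.Config → Prop
  | nil : Reaches [] I.initial
  | snoc (l : List (Label n Op Ret)) (C : I.Config) (s : Label n Op Ret) (C' : I.Config) :
      Reaches l C → I.Step C s C' → Reaches (l ++ [s]) C'

/-- The implementation is a recoverable implementation of the object `O`: all its finite histories
satisfy NRL. -/
def Recoverable (O : SeqObject.{u, v, w} Op Ret) : Prop :=
  ∀ (l : List (Label n Op Ret)) (C : I.Config), I.Reaches l C →
    History.NRL O (l.filterMap Label.toEvent?)

/-- An infinite execution. -/
structure Execution where
  conf : ℕ → I.Config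
  label : ℕ → Label n Op Ret
  conf_zero : conf 0 = I.initial
  step : ∀ t, I.Step (conf t) (label t) (conf (t + 1))

/-- The operation with the instances `A` and its recovery procedure are lock-free: whenever,
from some time `T` on, a set `P` of processes that execute the operation or its recovery procedure
takes infinitely many steps and none of them crashes, some process completes its operation. (The
processes outside `P` may take steps and crash arbitrarily.) -/
def LockFree (A : Set Op) : Prop :=
  ∀ (E : I.Execution) (P : Set (Fin n)) (T : ℕ),
    (∀ p ∈ P, ∃ op ∈ A, ∃ σ, (E.conf T).status p = .running op σ) →
    (∀ t ≥ T, ∀ p ∈ P, E.label t ≠ .event (.crash p)) →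
    (∀ T' ≥ T, ∃ t ≥ T', (E.label t).proc ∈ P) →
    ∃ t ≥ T, ∃ q op r, E.label t = .event (.respond q op r)

/-- The operation instances in `A` terminate when they are executed alone: in a crash-free
execution, if `p` executes such an operation, no other process has a pending operation and only `p`
takes steps, then `p` completes its operation. -/
def TerminatesAlone (A : Set Op) : Prop :=
  ∀ (E : I.Execution) (p : Fin n) (T : ℕ),
    (∀ t q, E.label t ≠ .event (.crash q)) →
    (∃ op ∈ A, ∃ σ, (E.conf T).status p = .running op σ) →
    (∀ q, q ≠ p → ∃ σ, (E.conf T).status q = .idle σ) →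
    (∀ t ≥ T, (E.label t).proc = p) →
    ∃ t ≥ T, ∃ op r, E.label t = .event (.respond p op r)

end Implementation

/-! ### Swap -/

/-- The swap object with values in `V`: `SWAP(v)` replaces the current value by `v` and returns the
previous value. -/
def swapObject {V : Type u} (v₀ : V) : SeqObject.{u, u, u} V V where
  State := V
  init := v₀
  apply := fun cur v => (v, cur)

/-- Base objects (with arbitrary value domains) that support read, write and primitive swap. -/
def swapBase {Obj : Type a} (St : Obj → Type b) : BaseSystem.{a, b, b, b} where
  Obj := Obj
  St := St
  Prim := St
  Resp := fun o _ => St o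
  apply := fun _ v cur => (v, cur)

/-! ### Histories that extend a sequential one -/

namespace SeqObject

variable {Op : Type u} {Ret : Type v} {n : ℕ} (O : SeqObject.{u, v, w} Op Ret)

/-! The proof is a valency argument for two processes of which only one crashes. After the base
history, executed by `p` alone, `p` invokes `M x` and `q` invokes `M y`. When both complete,
linearizability makes exactly one of them return `z`, so the outcome is one bit: does `p` return
`z`? At the start the bit is open: `p` running alone returns `z`, but if `q` completes first, then
`q` returns `z` and `p` does not. The runs considered let `p` crash and recover, while `q` never
crashes.

The core is `Valency.exists_univalent`. Suppose that in every state `x` that `p` can reach alone,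
the pending step `f` of `q` would fix the bit, to `v x`. If a step `t` of `p` changes `v`, then `t`
must overwrite `f`: if they commute, or if `f` overwrites `t`, a crash of `p` gives equal memories
after `f` and erases what `p` knew, so both values of `v` coincide. If `t` overwrites `f`, then `p`,
crashing right after `t`, cannot tell whether `f` came before `t`; running alone it returns the old
value, although `v` has already changed. Completing this run brings `v` back, so there is a second
change in the opposite direction, and a crash right after it forces the opposite result on the same
solo run. This is absurd, so `v` is constant and the bit was fixed all along.

Conversely, from an undecided state `p` can always move to where the next step of `q` leaves the bit
undecided. Iterating this (`exists_univalent_joint`) yields an infinite execution in which `q` takes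
infinitely many steps without crashing. No operation completes, because a completion by either
process fixes the bit. This contradicts lock-freedom for the set `{q}`. -/

theorem legalFrom_append (s : O.State) (A A' : List (Fin n × Op × Ret)) :
    O.LegalFrom s (A ++ A') ↔
      O.LegalFrom s A ∧ O.LegalFrom (O.runOps s (A.map (·.2.1))) A' := by
  induction A generalizing s with
  | nil => simp [LegalFrom, runOps]
  | cons t A ih =>
    obtain ⟨p, op, r⟩ := t
    simp only [List.cons_append, LegalFrom, ih, List.map_cons, runOps, List.foldl_cons, and_assoc]

end SeqObject

namespace History

variable {n : ℕ} {Op : Type u} {Ret : Type v}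

@[simp] theorem sequential_nil : sequential ([] : List (Fin n × Op × Ret)) = [] := rfl

@[simp] theorem sequential_cons (t : Fin n × Op × Ret) (A : List (Fin n × Op × Ret)) :
    sequential (t :: A) =
      Event.invoke t.1 t.2.1 :: Event.respond t.1 t.2.1 t.2.2 :: sequential A := rfl

@[simp] theorem sequential_append (A A' : List (Fin n × Op × Ret)) :
    sequential (A ++ A') = sequential A ++ sequential A' := by
  simp [sequential]

theorem sequential_injective {A A' : List (Fin n × Op × Ret)}
    (h : sequential A = sequential A') : A = A' := by
  induction A generalizing A' with
  | nil => cases A' <;> simp_all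
  | cons t A ih =>
    cases A' with
    | nil => simp at h
    | cons t' A' =>
      simp only [sequential_cons, List.cons.injEq, Event.invoke.injEq, Event.respond.injEq] at h
      obtain ⟨-, ⟨h1, h2, h3⟩, h4⟩ := h
      rw [ih h4, Prod.ext h1 (Prod.ext h2 h3)]

theorem proj_sequential (p : Fin n) (A : List (Fin n × Op × Ret)) :
    proj p (sequential A) = sequential (A.filter (fun t => decide (t.1 = p))) := by
  induction A with
  | nil => rfl
  | cons t A ih =>
    have ih' : (sequential A).filter (fun e => decide (e.proc = p)) = _ := ih
    by_cases h : t.1 = p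
    · simpa [proj, List.filter_cons, h,
        show ∀ op, (Event.invoke p op : Event n Op Ret).proc = p from fun _ => rfl,
        show ∀ op r, (Event.respond p op r : Event n Op Ret).proc = p from fun _ _ => rfl]
        using ih'
    · simpa [proj, h, show ∀ op, (Event.invoke t.1 op : Event n Op Ret).proc = t.1 from fun _ => rfl,
        show ∀ op r, (Event.respond t.1 op r : Event n Op Ret).proc = t.1 from fun _ _ => rfl]
        using ih'

@[simp] theorem proj_append (p : Fin n) (H H' : List (Event n Op Ret)) :
    proj p (H ++ H') = proj p H ++ proj p H' := by
  simp [proj]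

theorem countP_isInvokeOf_sequential (p : Fin n) (A : List (Fin n × Op × Ret)) :
    (sequential A).countP (Event.isInvokeOf p) =
      (A.filter (fun t => decide (t.1 = p))).length := by
  induction A with
  | nil => rfl
  | cons t A ih =>
    by_cases h : t.1 = p <;>
      simp [Event.isInvokeOf, h, ih]

theorem countP_isRespondOf_sequential (p : Fin n) (A : List (Fin n × Op × Ret)) :
    (sequential A).countP (Event.isRespondOf p) =
      (A.filter (fun t => decide (t.1 = p))).length := by
  induction A with
  | nil => rfl
  | cons t A ih =>
    by_cases h : t.1 = p <;>
      simp [Event.isRespondOf, h, ih]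

/-- A response needs a pending invocation, and a complete sequential history has none. This is what
prevents a completion from adding responses. -/
theorem not_alternating (A : List (Fin n × Op × Ret)) (p : Fin n) (op : Op) (r : Ret)
    (l : List (Event n Op Ret)) : ¬ Alternating (sequential A ++ Event.respond p op r :: l) := by
  induction A with
  | nil => simp [Alternating]
  | cons t A ih => simpa [Alternating] using ih

/-- A history without pending operations has no other completion than itself. -/
theorem IsCompletion.eq {H H' : List (Event n Op Ret)} (h : IsCompletion H H')
    (hc : ∀ s, ∃ A, proj s H = sequential A) : H' = dropPending H := by
  obtain ⟨R, hR, hw, rfl⟩ := h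
  cases R with
  | nil => simp
  | cons e R =>
    exfalso
    obtain ⟨p, op, r, rfl⟩ := hR e (by simp)
    obtain ⟨A, hA⟩ := hc p
    have := hw p
    rw [proj_append, hA] at this
    simp only [proj, List.filter_cons, Event.proc, decide_true, if_true] at this
    exact not_alternating _ _ _ _ _ this

theorem dropPending_sequential (A : List (Fin n × Op × Ret)) (H : List (Event n Op Ret)) :
    dropPending (sequential A ++ H) = sequential A ++ dropPending H := by
  induction A with
  | nil => rfl
  | cons t A ih => simp [dropPending, Event.isRespondOf, ih]

theorem happensBefore_append (U W Z : List (Event n Op Ret)) (p q : Fin n) (op op' : Op) (r : Ret)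
    (k k' : ℕ) (hk : U.countP (Event.isRespondOf p) = k)
    (hk' : (U ++ Event.respond p op r :: W).countP (Event.isInvokeOf q) = k') :
    HappensBefore ((U ++ Event.respond p op r :: W) ++ Event.invoke q op' :: Z) (p, k) (q, k') := by
  refine ⟨U.length, (U ++ Event.respond p op r :: W).length, .respond p op r, .invoke q op',
    by simp, by simp, by simp [Event.isRespondOf], by simpa using hk, ?_,
    by simp [Event.isInvokeOf], ?_⟩
  · rw [List.getElem?_append_right le_rfl]; simp
  · rw [List.take_left']
    · exact hk'
    · rfl

/-- The displayed invocation is at or after the first one by `q`, so the response number `k`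
(counted from `0`) lies inside `sequential L₁`, which therefore contains at least `k + 1`
operations. -/
theorem lt_of_happensBefore {L₁ : List (Fin n × Op × Ret)} {Z : List (Event n Op Ret)}
    {p q : Fin n} {op : Op} {k : ℕ}
    (h : HappensBefore (sequential L₁ ++ Event.invoke q op :: Z) (p, k) (q, 0)) :
    k < L₁.length := by
  obtain ⟨i, j, e₁, e₂, hij, hi, hr, hk, hj, -, hk'⟩ := h
  simp only at hr hk hk'
  set H := sequential L₁ ++ Event.invoke q op :: Z with hH
  have hjle : j ≤ (sequential L₁).length := by
    by_contra hlt
    push Not at hlt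
    have : (H.take ((sequential L₁).length + 1)).Sublist (H.take j) :=
      (List.take_prefix_take_left (by omega)).sublist
    have h2 := this.countP_le (p := Event.isInvokeOf q)
    rw [hk', hH, List.take_append] at h2
    simp [Event.isInvokeOf] at h2
  have h1 : (H.take (i + 1)).countP (Event.isRespondOf p) = k + 1 := by
    rw [List.take_add_one, hi]
    simp [hk, hr]
  have h2 : (H.take (i + 1)).Sublist (sequential L₁) := by
    have : (H.take (i + 1)).Sublist (H.take (sequential L₁).length) :=
      (List.take_prefix_take_left (by omega)).sublist
    have h0 : H.take (sequential L₁).length = sequential L₁ := List.take_left' rfl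
    rwa [h0] at this
  have h3 := h2.countP_le (p := Event.isRespondOf p)
  rw [h1, countP_isRespondOf_sequential] at h3
  exact lt_of_lt_of_le (Nat.lt_of_succ_le h3) (List.length_filter_le _ _)

/-! ### Linearizations of a sequential prefix followed by one or two operations -/

section Linearizations

variable {p q : Fin n} {A : List (Fin n × Op × Ret)}

theorem filter_of_proc (hA : ∀ t ∈ A, t.1 = p) (s : Fin n) :
    A.filter (fun t => decide (t.1 = s)) = if s = p then A else [] := by
  split_ifs with h
  · exact List.filter_eq_self.2 fun t ht => by simp [hA t ht, h]
  · exact List.filter_eq_nil_iff.2 fun t ht => by simp [hA t ht, Ne.symm h]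

/-- A linearization of a history that consists of operations of `p` and one operation `q`. -/
theorem split_linearization {L A' : List (Fin n × Op × Ret)} {t : Op × Ret}
    (hL : ∀ s, L.filter (fun t => decide (t.1 = s)) =
      if s = p then A' else if s = q then [(q, t)] else []) (hpq : p ≠ q) :
    ∃ L₁ L₂, L = L₁ ++ (q, t) :: L₂ ∧ A' = L₁ ++ L₂ := by
  have hmem : (q, t) ∈ L := by
    have : (q, t) ∈ L.filter (fun t => decide (t.1 = q)) := by
      rw [hL q, if_neg hpq.symm, if_pos rfl]; simp
    exact (List.mem_filter.1 this).1
  obtain ⟨L₁, L₂, rfl⟩ := List.append_of_mem hmem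
  refine ⟨L₁, L₂, rfl, ?_⟩
  have hq := hL q
  rw [if_neg hpq.symm, if_pos rfl] at hq
  have hq' := congrArg List.length hq
  simp only [List.filter_append, List.filter_cons, decide_true, if_true, List.length_append,
    List.length_cons, List.length_nil] at hq'
  have h1 : ∀ x ∈ L₁ ++ L₂, x.1 = p := by
    intro x hx
    have hxs := hL x.1
    by_contra hxp
    rw [if_neg hxp] at hxs
    have hxm : x ∈ (L₁ ++ (q, t) :: L₂).filter (fun t => decide (t.1 = x.1)) := by
      rw [List.mem_filter]
      simp only [List.mem_append, List.mem_cons, decide_true, and_true] at hx ⊢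
      tauto
    rw [hxs] at hxm
    by_cases hxq : x.1 = q
    · have h0 : (L₁.filter (fun t => decide (t.1 = q))) = [] ∧
          (L₂.filter (fun t => decide (t.1 = q))) = [] := by
        constructor <;> apply List.length_eq_zero_iff.1 <;> omega
      rw [List.filter_eq_nil_iff, List.filter_eq_nil_iff] at h0
      rcases List.mem_append.1 hx with h | h
      · exact h0.1 x h (by simp [hxq])
      · exact h0.2 x h (by simp [hxq])
    · simp [hxq] at hxm
  have hp := hL p
  rw [if_pos rfl, List.filter_append, List.filter_cons, if_neg (by simp [hpq.symm])] at hp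
  rw [← List.filter_append, filter_of_proc h1, if_pos rfl] at hp
  exact hp.symm

theorem Linearizable.exists_legal {O : SeqObject.{u, v, w} Op Ret} {H : List (Event n Op Ret)}
    (h : Linearizable O H) (F : Fin n → List (Fin n × Op × Ret))
    (hF : ∀ s, proj s H = sequential (F s)) (hd : dropPending H = H) :
    ∃ L : List (Fin n × Op × Ret), O.LegalFrom O.init L ∧
      (∀ s, L.filter (fun t => decide (t.1 = s)) = F s) ∧
      ∀ o₁ o₂, HappensBefore H o₁ o₂ → o₁.2 < (F o₁.1).length → o₂.2 < (F o₂.1).length →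
        HappensBefore (sequential L) o₁ o₂ := by
  obtain ⟨H', L, hc, hleg, hp, hb⟩ := h
  have hH' : H' = H := (hc.eq fun s => ⟨_, hF s⟩).trans hd
  subst hH'
  have hL : ∀ s, L.filter (fun t => decide (t.1 = s)) = F s := fun s =>
    sequential_injective (by rw [← proj_sequential, ← hp s, hF s])
  refine ⟨L, hleg, hL, fun o₁ o₂ h h₁ h₂ => hb o₁ o₂ h ?_ ?_⟩
  · rwa [Appears, countP_isInvokeOf_sequential, hL]
  · rwa [Appears, countP_isInvokeOf_sequential, hL]

/-- Real-time order forces the operation of `q` behind all of `A`, so only the operations of `p`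
after `A` can be ordered on either side of it. -/
theorem Linearizable.split {O : SeqObject.{u, v, w} Op Ret} {W Z : List (Event n Op Ret)}
    {A' : List (Fin n × Op × Ret)} {t : Op × Ret} (hpq : p ≠ q) (hA : ∀ x ∈ A, x.1 = p)
    (hAA' : A.length ≤ A'.length)
    (h : Linearizable O (sequential A ++ (W ++ Event.invoke q t.1 :: Z)))
    (hW : W.countP (Event.isInvokeOf q) = 0)
    (hF : ∀ s, proj s (sequential A ++ (W ++ Event.invoke q t.1 :: Z)) =
      sequential (if s = p then A' else if s = q then [(q, t)] else []))
    (hd : dropPending (W ++ Event.invoke q t.1 :: Z) = W ++ Event.invoke q t.1 :: Z) :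
    ∃ L₁ L₂, A' = L₁ ++ L₂ ∧ A.length ≤ L₁.length ∧
      O.LegalFrom O.init (L₁ ++ (q, t) :: L₂) := by
  obtain ⟨L, hleg, hL, hb⟩ := h.exists_legal _ hF (by rw [dropPending_sequential, hd])
  obtain ⟨L₁, L₂, rfl, rfl⟩ := split_linearization hL hpq
  refine ⟨L₁, L₂, rfl, ?_, hleg⟩
  rcases List.eq_nil_or_concat A with rfl | ⟨A₀, a, rfl⟩
  · simp
  have ha : a.1 = p := hA a (by simp)
  have hA₀ : ∀ x ∈ A₀, x.1 = p := fun x hx => hA x (by simp [hx])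
  -- Numbering starts at `0`, so `A₀.length` names the last operation of `A`; it suffices to compare
  -- this one with the operation of `q`.
  have key := hb (p, A₀.length) (q, 0) ?_ ?_ ?_
  · rw [sequential_append, sequential_cons] at key
    simpa using lt_of_happensBefore key
  · have := happensBefore_append (sequential A₀ ++ [Event.invoke p a.2.1]) W
      Z p q a.2.1 t.1 a.2.2 A₀.length 0
      (by simp [countP_isRespondOf_sequential, filter_of_proc hA₀, Event.isRespondOf])
      (by simp [countP_isInvokeOf_sequential, filter_of_proc hA₀, hpq.symm, Event.isInvokeOf, hW,
        hpq])
    simpa [ha] using this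
  · simp only [if_true]
    simp only [List.concat_eq_append, List.length_append, List.length_cons, List.length_nil]
      at hAA' ⊢
    omega
  · simp [hpq.symm]

theorem proj_sequential_of_proc (hA : ∀ t ∈ A, t.1 = p) (s : Fin n) :
    proj s (sequential A) = if s = p then sequential A else [] := by
  rw [proj_sequential, filter_of_proc hA]
  split_ifs <;> rfl

/-- After a sequential history of `p`, an operation of `p` returns what the object prescribes. -/
theorem Linearizable.response_same {O : SeqObject.{u, v, w} Op Ret} (hA : ∀ t ∈ A, t.1 = p)
    {op : Op} {r : Ret}
    (h : Linearizable O (sequential A ++ [Event.invoke p op, Event.respond p op r])) :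
    r = (O.apply (O.runOps O.init (A.map (·.2.1))) op).2 := by
  have hA' : ∀ t ∈ A ++ [(p, op, r)], t.1 = p := by
    intro t ht
    rcases List.mem_append.1 ht with h | h
    · exact hA t h
    · simp_all
  have e : sequential A ++ [Event.invoke p op, Event.respond p op r] =
      sequential (A ++ [(p, op, r)]) := by simp
  rw [e] at h
  obtain ⟨L, hleg, hL, -⟩ := h.exists_legal (fun s => if s = p then A ++ [(p, op, r)] else [])
    (fun s => by rw [proj_sequential, filter_of_proc hA']) (by
      have := dropPending_sequential (A ++ [(p, op, r)]) ([] : List (Event n Op Ret))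
      simpa only [List.append_nil, dropPending] using this)
  have hLp : ∀ t ∈ L, t.1 = p := by
    intro t ht
    by_contra hne
    have h1 : t ∈ L.filter (fun x => decide (x.1 = t.1)) := by simp [ht]
    rw [hL, if_neg hne] at h1
    simp at h1
  have hLA := hL p
  rw [filter_of_proc hLp, if_pos rfl, if_pos rfl] at hLA
  rw [hLA, O.legalFrom_append] at hleg
  exact hleg.2.1.symm

/-- After a sequential history of `p`, an operation of `q` returns what the object prescribes. -/
theorem Linearizable.response_other {O : SeqObject.{u, v, w} Op Ret} (hA : ∀ t ∈ A, t.1 = p)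
    (hpq : p ≠ q) {op : Op} {r : Ret}
    (h : Linearizable O (sequential A ++ [Event.invoke q op, Event.respond q op r])) :
    r = (O.apply (O.runOps O.init (A.map (·.2.1))) op).2 := by
  obtain ⟨L₁, L₂, h1, h2, hleg⟩ := Linearizable.split (A' := A) (t := (op, r)) (W := [])
    (Z := [Event.respond q op r]) hpq hA le_rfl h rfl (fun s => by
      rw [proj_append, proj_sequential_of_proc hA]
      by_cases hs : s = p
      · subst hs; simp [proj, Event.proc, hpq.symm]
      · by_cases hq : s = q
        · subst hq; simp [proj, Event.proc, hs]
        · simp [proj, Event.proc, hs, hq, Ne.symm hq]) (by simp [dropPending, Event.isRespondOf])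
  have h3 := congrArg List.length h1
  rw [List.length_append] at h3
  obtain rfl : L₂ = [] := List.length_eq_zero_iff.1 (by omega)
  rw [List.append_nil] at h1
  subst h1
  exact ((O.legalFrom_append _ _ _).1 hleg).2.1.symm

/-- After a sequential history of `p`, concurrent operations of `p` and `q` return what the object
prescribes for one of the two orders. -/
theorem Linearizable.response_pair {O : SeqObject.{u, v, w} Op Ret} (hA : ∀ t ∈ A, t.1 = p)
    (hpq : p ≠ q) {op op' : Op} {r r' : Ret} {rs : List (Event n Op Ret)}
    (hrs : rs.Perm [Event.respond p op r, Event.respond q op' r'])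
    (h : Linearizable O (sequential A ++ (Event.invoke p op :: Event.invoke q op' :: rs))) :
    ((O.apply (O.runOps O.init (A.map (·.2.1))) op).2 = r ∧
      (O.apply (O.apply (O.runOps O.init (A.map (·.2.1))) op).1 op').2 = r') ∨
    ((O.apply (O.runOps O.init (A.map (·.2.1))) op').2 = r' ∧
      (O.apply (O.apply (O.runOps O.init (A.map (·.2.1))) op').1 op).2 = r) := by
  have hrs' : rs = [Event.respond p op r, Event.respond q op' r'] ∨
      rs = [Event.respond q op' r', Event.respond p op r] := List.perm_pair.1 hrs
  obtain ⟨L₁, L₂, h1, h2, hleg⟩ := Linearizable.split (A' := A ++ [(p, op, r)]) (t := (op', r'))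
    (W := [Event.invoke p op]) (Z := rs) hpq hA (by simp) h
    (by simp [Event.isInvokeOf, hpq]) (fun s => by
      rw [proj_append, proj_sequential_of_proc hA]
      by_cases hs : s = p
      · subst hs
        rcases hrs' with rfl | rfl <;> simp [proj, Event.proc, hpq.symm]
      · by_cases hq : s = q
        · subst hq
          rcases hrs' with rfl | rfl <;> simp [proj, Event.proc, hpq, hs]
        · rcases hrs' with rfl | rfl <;> simp [proj, Event.proc, hs, hq, Ne.symm hq, Ne.symm hs])
    (by rcases hrs' with rfl | rfl <;> simp [dropPending, Event.isRespondOf])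
  have h3 := congrArg List.length h1
  simp only [List.length_append, List.length_cons, List.length_nil] at h3
  rcases L₂ with _ | ⟨t, L₂⟩
  · left
    rw [List.append_nil] at h1
    subst h1
    rw [List.append_assoc, O.legalFrom_append] at hleg
    exact ⟨hleg.2.1, hleg.2.2.1⟩
  · right
    obtain rfl : L₂ = [] := List.length_eq_zero_iff.1 (by
      simp only [List.length_cons] at h3; omega)
    obtain ⟨rfl, h4⟩ := List.append_inj' h1 rfl
    obtain rfl := List.cons.inj h4 |>.1
    rw [O.legalFrom_append] at hleg
    exact ⟨hleg.2.1, hleg.2.2.1⟩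

end Linearizations

end History

/-! ### A valency argument for two processes, one of which may crash -/

namespace Valency

variable {Mem : Type u} {P : Type v} {Q : Type w}

/-- The steps of two processes that share a memory: a step of the first or of the second one. -/
inductive Joint (pm : Mem × P → Mem × P → Prop) (qm : Mem × Q → Mem × Q → Prop) :
    Mem × P × Q → Mem × P × Q → Prop
  | left (m : Mem) (s : P) (k : Q) (m' : Mem) (s' : P) (h : pm (m, s) (m', s')) :
      Joint pm qm (m, s, k) (m', s', k)
  | right (m : Mem) (s : P) (k : Q) (m' : Mem) (k' : Q) (h : qm (m, k) (m', k')) :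
      Joint pm qm (m, s, k) (m', s, k')

/-- Every joint run from `G` in which the first process gets a result gives the result `b`. -/
def Univalent (pm : Mem × P → Mem × P → Prop) (qm : Mem × Q → Mem × Q → Prop)
    (res : P → Option Bool) (G : Mem × P × Q) (b : Bool) : Prop :=
  ∀ G', Relation.ReflTransGen (Joint pm qm) G G' → ∀ c, res G'.2.1 = some c → c = b

/-- Every run of the first process alone from `x` that gives a result gives the result `b`. -/
def SoloUnivalent (pm : Mem × P → Mem × P → Prop) (res : P → Option Bool) (x : Mem × P)
    (b : Bool) : Prop :=
  ∀ y, Relation.ReflTransGen pm x y → ∀ c, res y.2 = some c → c = b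

variable {pm : Mem × P → Mem × P → Prop} {qm : Mem × Q → Mem × Q → Prop} {res : P → Option Bool}

theorem joint_of_solo (k : Q) {x y : Mem × P} (h : Relation.ReflTransGen pm x y) :
    Relation.ReflTransGen (Joint pm qm) (x.1, x.2, k) (y.1, y.2, k) := by
  induction h with
  | refl => exact .refl
  | tail _ h ih => exact ih.tail (.left _ _ _ _ _ h)

theorem joint_of_solo_right (s : P) {x y : Mem × Q} (h : Relation.ReflTransGen qm x y) :
    Relation.ReflTransGen (Joint pm qm) (x.1, s, x.2) (y.1, s, y.2) := by
  induction h with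
  | refl => exact .refl
  | tail _ h ih => exact ih.tail (.right _ _ _ _ _ h)

theorem Univalent.mono {G G' : Mem × P × Q} {b : Bool} (h : Univalent pm qm res G b)
    (hG : Relation.ReflTransGen (Joint pm qm) G G') : Univalent pm qm res G' b :=
  fun _ h' => h _ (hG.trans h')

theorem SoloUnivalent.mono {x y : Mem × P} {b : Bool} (h : SoloUnivalent pm res x b)
    (hy : Relation.ReflTransGen pm x y) : SoloUnivalent pm res y b :=
  fun _ h' => h _ (hy.trans h')

theorem Univalent.solo {x : Mem × P} {k : Q} {b : Bool}
    (h : Univalent pm qm res (x.1, x.2, k) b) : SoloUnivalent pm res x b :=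
  fun _ hy => h _ (joint_of_solo k hy)

theorem exists_change {α : Type*} {r : α → α → Prop} (v : α → Bool) {x y : α}
    (h : Relation.ReflTransGen r x y) (hv : v y ≠ v x) :
    ∃ x' y', Relation.ReflTransGen r x x' ∧ r x' y' ∧ v x' = v x ∧ v y' ≠ v x := by
  induction h with
  | refl => exact absurd rfl hv
  | @tail y z hy hz ih =>
    by_cases h : v y = v x
    · exact ⟨y, z, hy, hz, h, hv⟩
    · exact ih h

/-- A step of the first process as seen by the next step `f` of the second one: it does not use the
memory, or it transforms the memory by `t`, where `t` and `f` interfere. In both cases the process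
can crash before and afterwards, which leads it to the state `dn`. -/
def StepShape (pm : Mem × P → Mem × P → Prop) (dn : P) (f : Mem → Mem) (x y : Mem × P) : Prop :=
  (y.1 = x.1 ∧ ∀ m, pm (m, x.2) (m, y.2)) ∨
  ∃ t : Mem → Mem, y.1 = t x.1 ∧ (∀ m, pm (m, x.2) (m, dn)) ∧ (∀ m, pm (m, y.2) (m, dn)) ∧
    (∀ m, ∃ s, pm (m, x.2) (t m, s) ∧ pm (t m, s) (t m, dn)) ∧
    ∀ m, f (t m) = t (f m) ∨ f (t m) = f m ∨ t (f m) = t m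

/-- If the next step of the second process decides the result in every state that the first process
can reach alone (with crashes), then the result is already decided. -/
theorem exists_univalent (dn : P) (f : Mem → Mem) (g : Mem → Q) (k : Q) (x₀ : Mem × P)
    (hq : ∀ m y, qm (m, k) y ↔ y = (f m, g m))
    (shape : ∀ x y, pm x y → StepShape pm dn f x y)
    (term : ∀ G, Relation.ReflTransGen (Joint pm qm) (x₀.1, x₀.2, k) G →
      ∃ y c, Relation.ReflTransGen pm (G.1, G.2.1) y ∧ res y.2 = some c)
    (dead : ∀ x, Relation.ReflTransGen pm x₀ x → ∃ b, Univalent pm qm res (f x.1, x.2, g x.1) b) :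
    ∃ b, Univalent pm qm res (x₀.1, x₀.2, k) b := by
  classical
  -- `v x` is the result fixed by the step of `q` taken at `x`. The default `false` is right at
  -- states reachable by `p` alone, since `dead` provides some fixed value there.
  let v : Mem × P → Bool := fun x =>
    if Univalent pm qm res (f x.1, x.2, g x.1) true then true else false
  have hv : ∀ x, Relation.ReflTransGen pm x₀ x →
      Univalent pm qm res (f x.1, x.2, g x.1) (v x) := by
    intro x hx
    obtain ⟨b, hb⟩ := dead x hx
    by_cases h : Univalent pm qm res (f x.1, x.2, g x.1) true
    · simp [v, h]
    · cases b
      · simpa [v, h] using hb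
      · exact absurd hb h
  have qstep : ∀ x : Mem × P, Joint pm qm (x.1, x.2, k) (f x.1, x.2, g x.1) :=
    fun x => .right _ _ _ _ _ ((hq _ _).2 rfl)
  have term₁ : ∀ x, Relation.ReflTransGen pm x₀ x →
      ∃ y c, Relation.ReflTransGen pm x y ∧ res y.2 = some c :=
    fun x hx => term _ (joint_of_solo k hx)
  have term₂ : ∀ x, Relation.ReflTransGen pm x₀ x → ∀ y, Relation.ReflTransGen pm (f x.1, x.2) y →
      ∃ z c, Relation.ReflTransGen pm y z ∧ res z.2 = some c :=
    fun x hx y hy => term _ (((joint_of_solo k hx).tail (qstep x)).trans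
      (joint_of_solo (g x.1) hy))
  have solo : ∀ x, Relation.ReflTransGen pm x₀ x → SoloUnivalent pm res (f x.1, x.2) (v x) :=
    fun x hx => Univalent.solo (hv x hx)
  -- A step that ignores the memory can also be taken after `f`, so a run witnessing `v y` also
  -- witnesses `v x`.
  have neutral : ∀ x y, Relation.ReflTransGen pm x₀ x → pm x y → y.1 = x.1 →
      (∀ m, pm (m, x.2) (m, y.2)) → v y = v x := by
    intro x y hx hxy hm h
    obtain ⟨z, c, hz, hc⟩ := term₂ y (hx.tail hxy) _ .refl
    have h1 := solo y (hx.tail hxy) z hz c hc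
    rw [hm] at hz
    have h2 := solo x hx z (.head (h _) hz) c hc
    rw [← h1, ← h2]
  have change : ∀ x y, Relation.ReflTransGen pm x₀ x → pm x y → v y ≠ v x →
      (∀ m, pm (m, y.2) (m, dn)) ∧ SoloUnivalent pm res (y.1, dn) (v x) := by
    intro x y hx hxy hne
    rcases shape x y hxy with ⟨hm, h⟩ | ⟨t, hm, hcx, hcr, hacc, hint⟩
    · exact absurd (neutral x y hx hxy hm h) hne
    refine ⟨hcr, ?_⟩
    obtain ⟨s, hs, hs'⟩ := hacc (f x.1)
    have hx' : SoloUnivalent pm res (t (f x.1), dn) (v x) :=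
      (solo x hx).mono ((Relation.ReflTransGen.single hs).tail hs')
    have hy' : SoloUnivalent pm res (f (t x.1), dn) (v y) := by
      have := (solo y (hx.tail hxy)).mono (.single (hcr _))
      rwa [hm] at this
    -- If the steps commute, or if `f` overwrites `t`, then a crash of `p` leads to one solo run
    -- witnessing both values. Only a `t` that overwrites `f` is left, and then the crashed state
    -- after `f` and `t` is the one after `t` alone.
    rcases hint x.1 with h | h | h
    · rw [h] at hy'
      obtain ⟨z, c, hz, hc⟩ := term₂ x hx _ ((Relation.ReflTransGen.single hs).tail hs')
      exact absurd ((hy' z hz c hc).symm.trans (hx' z hz c hc)) hne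
    · rw [h] at hy'
      obtain ⟨z, c, hz, hc⟩ := term₂ y (hx.tail hxy) _ (.single (hcr _))
      rw [hm, h] at hz
      exact absurd ((hy' z hz c hc).symm.trans (solo x hx z (.head (hcx _) hz) c hc)) hne
    · rw [h] at hx'
      rwa [hm]
  by_contra hno
  have hex : ∃ x, Relation.ReflTransGen pm x₀ x ∧ v x ≠ v x₀ := by
    by_contra hall
    push Not at hall
    refine hno ⟨v x₀, fun G hG c hc => ?_⟩
    -- With `v` constant, a joint run either has no step of `q` yet, or has passed through `f` at a
    -- state reachable by `p` alone and is decided since then.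
    have key : (∃ s, Relation.ReflTransGen pm x₀ (G.1, s) ∧ G.2 = (s, k)) ∨
        Univalent pm qm res G (v x₀) := by
      clear hc
      induction hG with
      | refl => exact .inl ⟨_, .refl, rfl⟩
      | @tail G G' _ hstep ih =>
        rcases ih with ⟨s, hs, hGs⟩ | h
        · cases hstep with
          | left m s₁ k₁ m' s' h =>
            obtain ⟨rfl, rfl⟩ := Prod.mk.inj hGs
            exact .inl ⟨_, hs.tail h, rfl⟩
          | right m s₁ k₁ m' k' h =>
            obtain ⟨rfl, rfl⟩ := Prod.mk.inj hGs
            obtain ⟨rfl, rfl⟩ := Prod.mk.inj ((hq _ _).1 h)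
            have := hv _ hs
            rw [hall _ hs] at this
            exact .inr this
        · exact .inr (h.mono (.single hstep))
    rcases key with ⟨s, hs, hGs⟩ | h
    · have h1 := hv _ hs _ .refl c (by rw [hGs] at hc; exact hc)
      rw [hall _ hs] at h1
      exact h1
    · exact h _ .refl c hc
  obtain ⟨x, hx, hne⟩ := hex
  obtain ⟨x₁, y₁, hx₁, hxy₁, hvx₁, hvy₁⟩ := exists_change v hx hne
  obtain ⟨hcr₁, hs₁⟩ := change x₁ y₁ hx₁ hxy₁ (hvx₁ ▸ hvy₁)
  have hy₁ := hx₁.tail hxy₁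
  have hd₁ : Relation.ReflTransGen pm x₀ (y₁.1, dn) := hy₁.tail (hcr₁ _)
  -- The crash keeps the new value of `v`, while `hs₁` makes `p` alone return the old one.
  have hvd : v (y₁.1, dn) = v y₁ := neutral _ _ hy₁ (hcr₁ _) rfl hcr₁
  obtain ⟨z, c, hz, hc⟩ := term₁ _ hd₁
  have hc₁ : c = v x₀ := (hs₁ z hz c hc).trans hvx₁
  -- At `z` the result is already there, and the step of `q` does not touch it.
  have hvz : v z = v x₀ := by
    rw [← hc₁]
    exact (hv z (hd₁.trans hz) _ .refl c hc).symm
  obtain ⟨x₂, y₂, hx₂, hxy₂, hvx₂, hvy₂⟩ :=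
    exists_change v hz (by rw [hvd, hvz]; exact hvy₁.symm)
  obtain ⟨hcr₂, hs₂⟩ := change x₂ y₂ (hd₁.trans hx₂) hxy₂ (hvx₂ ▸ hvy₂)
  have hd₂ : Relation.ReflTransGen pm (y₁.1, dn) (y₂.1, dn) := (hx₂.tail hxy₂).tail (hcr₂ _)
  -- One completed solo run after the second crash: `hs₁` still governs it and demands `v x₀`,
  -- whereas `hs₂` demands `v y₁`.
  obtain ⟨z', c', hz', hc'⟩ := term₁ _ (hd₁.trans hd₂)
  have h1 := hs₁ z' (hd₂.trans hz') c' hc'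
  have h2 := hs₂ z' hz' c' hc'
  rw [hvx₁] at h1
  rw [hvx₂, hvd] at h2
  exact hvy₁ (h2.symm.trans h1)

/-- `G` has a run of `N` steps of the first process to a state in which the next step of the second
process leads to a state in `S`. -/
inductive Distance (pm : Mem × P → Mem × P → Prop) (qm : Mem × Q → Mem × Q → Prop)
    (S : Mem × P × Q → Prop) : ℕ → Mem × P × Q → Prop
  | zero (m : Mem) (s : P) (k : Q) (m' : Mem) (k' : Q) (h : qm (m, k) (m', k'))
      (hS : S (m', s, k')) : Distance pm qm S 0 (m, s, k)
  | succ (N : ℕ) (m : Mem) (s : P) (k : Q) (m' : Mem) (s' : P) (h : pm (m, s) (m', s'))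
      (hd : Distance pm qm S N (m', s', k)) : Distance pm qm S (N + 1) (m, s, k)

theorem Distance.of_run {S : Mem × P × Q → Prop} {x y : Mem × P} {k k' : Q} {m : Mem}
    (hxy : Relation.ReflTransGen pm x y) (h : qm (y.1, k) (m, k')) (hS : S (m, y.2, k')) :
    ∃ N, Distance pm qm S N (x.1, x.2, k) := by
  induction hxy using Relation.ReflTransGen.head_induction_on with
  | refl => exact ⟨0, .zero _ _ _ _ _ h hS⟩
  | head h _ ih =>
    obtain ⟨N, ih⟩ := ih
    exact ⟨N + 1, .succ _ _ _ _ _ _ h ih⟩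

theorem Distance.exists_mem {S : Mem × P × Q → Prop} {N : ℕ} {G : Mem × P × Q}
    (h : Distance pm qm S N G) : ∃ G', Relation.ReflTransGen (Joint pm qm) G G' ∧ S G' := by
  induction h with
  | zero m s k m' k' h hS => exact ⟨_, .single (.right _ _ _ _ _ h), hS⟩
  | succ N m s k m' s' h _ ih =>
    obtain ⟨G', h1, h2⟩ := ih
    exact ⟨G', .head (.left _ _ _ _ _ h) h1, h2⟩

end Valency

/-! ### The steps of a single process -/

/-- The state of a process in the course of one operation. -/
inductive View (Local : Type e) (Ret : Type v) : Type (max e v)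
  | run (σ : Local)
  | down
  | done (r : Ret) (σ : Local)

namespace View

variable {n : ℕ} {Op : Type u} {Ret : Type v} {Local : Type e}

/-- The status of a process that executes `op`; crashes set the local state to `σ₀`. -/
def toStatus (op : Op) (σ₀ : Local) : View Local Ret → Status Op Local
  | run σ => .running op σ
  | down => .crashed op σ₀
  | done _ σ => .idle σ

/-- The response to the operation `op` of `p`, if there is one. -/
def resp (p : Fin n) (op : Op) : View Local Ret → List (Event n Op Ret)
  | done r _ => [.respond p op r]
  | _ => []

open Classical in
/-- Has the operation returned `z`? -/
noncomputable def result (z : Ret) : View Local Ret → Option Bool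
  | done r _ => some (decide (r = z))
  | _ => none

end View

/-! ### Instructions as transformations of the memory, and their interference -/

namespace BaseSystem

variable (B : BaseSystem.{a, b, c, d})

/-- The states of all base objects. -/
abbrev Mem := (o : B.Obj) → B.St o

end BaseSystem

namespace Instr

variable {B : BaseSystem.{a, b, c, d}} {Local : Type e} {Ret : Type v}

open Classical in
/-- The effect of a step on the base objects. -/
noncomputable def effect : Instr B Local Ret → B.Mem → B.Mem
  | read _ _, m => m
  | write o x _, m => Function.update m o x
  | prim o f _, m => Function.update m o (B.apply o f (m o)).1
  | ret _ _, m => m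

/-- The state of the process after a step. -/
def view : Instr B Local Ret → B.Mem → View Local Ret
  | read o next, m => .run (next (m o))
  | write _ _ next, _ => .run next
  | prim o f next, m => .run (next (B.apply o f (m o)).2)
  | ret r next, _ => .done r next

/-- The label of a step. -/
def label {n : ℕ} {Op : Type u} (p : Fin n) (op : Op) : Instr B Local Ret → Label n Op Ret
  | ret r _ => .event (.respond p op r)
  | _ => .access p

-- Updates of different objects commute, so interference has to be checked only when both act on the
-- same object.
open Classical in
theorem interfere_of_update {o o' : B.Obj} (φ : B.St o → B.St o) (ψ : B.St o' → B.St o')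
    (m : B.Mem)
    (h : ∀ e : o = o', ψ (e ▸ φ (m o)) = e ▸ φ (e ▸ ψ (m o')) ∨ ψ (e ▸ φ (m o)) = ψ (m o') ∨
      φ (e ▸ ψ (m o')) = φ (m o)) :
    let F : B.Mem → B.Mem := fun m => Function.update m o (φ (m o))
    let G : B.Mem → B.Mem := fun m => Function.update m o' (ψ (m o'))
    G (F m) = F (G m) ∨ G (F m) = G m ∨ F (G m) = F m := by
  intro F G
  by_cases e : o = o'
  · subst e
    have := h rfl
    simp only [F, G, Function.update_self, Function.update_idem] at this ⊢
    rcases this with h | h | h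
    · exact .inl (by rw [h])
    · exact .inr (.inl (by rw [h]))
    · exact .inr (.inr (by rw [h]))
  · left
    simp only [F, G, Function.update_of_ne e, Function.update_of_ne (Ne.symm e)]
    exact Function.update_comm e _ _ m

/-- Reads and returns act as the identity and commute with everything, a write overwrites any update
of its object, and two primitives are covered by `hB`. -/
theorem interfere (hB : B.Interfering) (i j : Instr B Local Ret) (m : B.Mem) :
    j.effect (i.effect m) = i.effect (j.effect m) ∨ j.effect (i.effect m) = j.effect m ∨
      i.effect (j.effect m) = i.effect m := by
  cases i with
  | read o next => exact .inl rfl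
  | ret r next => exact .inl rfl
  | write o x next =>
    cases j with
    | read o next => exact .inl rfl
    | ret r next => exact .inl rfl
    | write o' x' next' =>
      exact interfere_of_update (fun _ => x) (fun _ => x') m fun e => .inr (.inl rfl)
    | prim o' g next' =>
      exact interfere_of_update (fun _ => x) (fun s => (B.apply o' g s).1) m
        fun e => .inr (.inr rfl)
  | prim o f next =>
    cases j with
    | read o next => exact .inl rfl
    | ret r next => exact .inl rfl
    | write o' x' next' =>
      exact interfere_of_update (fun s => (B.apply o f s).1) (fun _ => x') m
        fun e => .inr (.inl rfl)
    | prim o' g next' =>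
      refine interfere_of_update (fun s => (B.apply o f s).1) (fun s => (B.apply o' g s).1) m ?_
      rintro rfl
      exact hB o f g (m o)

end Instr

namespace Label

variable {n : ℕ} {Op : Type u} {Ret : Type v}

/-- The step is not a crash. -/
def NoCrash (x : Label n Op Ret) : Prop := ∀ p, x ≠ .event (.crash p)

/-- The step's contribution to the history without crash and recovery steps. -/
def events (x : Label n Op Ret) : List (Event n Op Ret) :=
  History.removeCrashes (x.toEvent?.toList)

end Label

namespace Implementation

variable {B : BaseSystem.{a, b, c, d}} {n : ℕ} {Op : Type u} {Ret : Type v}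
  (I : Implementation.{u, v, a, b, c, d, e} B n Op Ret)

/-- A step of `p` inside an operation or its recovery procedure. -/
def Solo (p : Fin n) (x y : B.Mem × View I.Local Ret) : Prop :=
  ∃ σ, x.2 = .run σ ∧ y = ((I.code p σ).effect x.1, (I.code p σ).view x.1)

/-- A step of `p` while the operation `op` is pending, possibly a crash or a recovery step. -/
inductive Move (p : Fin n) (op : Op) (k : ℕ) :
    B.Mem × View I.Local Ret → Label n Op Ret → B.Mem × View I.Local Ret → Prop
  | act (m : B.Mem) (σ : I.Local) : Move p op k (m, .run σ) ((I.code p σ).label p op)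
      ((I.code p σ).effect m, (I.code p σ).view m)
  | crash (m : B.Mem) (σ : I.Local) : Move p op k (m, .run σ) (.event (.crash p)) (m, .down)
  | recover (m : B.Mem) : Move p op k (m, .down) (.event (.recover p))
      (m, .run (I.recovery p op k (I.initLocal p)))

/-- `Move` without the label. -/
def MoveTo (p : Fin n) (op : Op) (k : ℕ) (x y : B.Mem × View I.Local Ret) : Prop :=
  ∃ lab, I.Move p op k x lab y

variable {I}

theorem Solo.moveTo {p : Fin n} (op : Op) (k : ℕ) {x y : B.Mem × View I.Local Ret}
    (h : I.Solo p x y) : I.MoveTo p op k x y := by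
  obtain ⟨m, s⟩ := x
  obtain ⟨σ, rfl, rfl⟩ := h
  exact ⟨_, .act m σ⟩

theorem Solo.reflTransGen_moveTo {p : Fin n} (op : Op) (k : ℕ) {x y : B.Mem × View I.Local Ret}
    (h : Relation.ReflTransGen (I.Solo p) x y) : Relation.ReflTransGen (I.MoveTo p op k) x y := by
  induction h with
  | refl => exact .refl
  | tail _ h ih => exact ih.tail (h.moveTo op k)

theorem Move.resp_eq_nil {p : Fin n} {op : Op} {k : ℕ} {x y : B.Mem × View I.Local Ret}
    {lab : Label n Op Ret} (h : I.Move p op k x lab y) : x.2.resp p op = [] := by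
  cases h <;> rfl

theorem Move.events_eq {p : Fin n} {op : Op} {k : ℕ} {x y : B.Mem × View I.Local Ret}
    {lab : Label n Op Ret} (h : I.Move p op k x lab y) : lab.events = y.2.resp p op := by
  cases h with
  | act m σ => cases I.code p σ <;> rfl
  | crash => rfl
  | recover => rfl

theorem Move.proc_eq {p : Fin n} {op : Op} {k : ℕ} {x y : B.Mem × View I.Local Ret}
    {lab : Label n Op Ret} (h : I.Move p op k x lab y) : lab.proc = p := by
  cases h with
  | act m σ => cases I.code p σ <;> rfl
  | crash => rfl
  | recover => rfl

theorem _root_.Instr.label_noCrash {Local : Type e} (i : Instr B Local Ret) (p : Fin n) (op : Op) :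
    (i.label p op).NoCrash := by
  intro q h
  cases i <;> simp [Instr.label] at h

namespace Config

/-- The configuration in which `p` executes `op` and has the state `x.2`, while the base objects
have the states `x.1`. -/
def setView (C : I.Config) (p : Fin n) (op : Op) (x : B.Mem × View I.Local Ret) : I.Config where
  mem := x.1
  status := Function.update C.status p (x.2.toStatus op (I.initLocal p))
  seq := C.seq

theorem setView_self (C : I.Config) (p : Fin n) (op : Op) (s : View I.Local Ret)
    (h : C.status p = s.toStatus op (I.initLocal p)) : C.setView p op (C.mem, s) = C := by
  simp [setView, ← h]

theorem setView_comm (C : I.Config) {p q : Fin n} (hpq : p ≠ q) (op op' : Op) (m : B.Mem)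
    (s s' : View I.Local Ret) :
    (C.setView q op' (m, s')).setView p op (m, s) =
      (C.setView p op (m, s)).setView q op' (m, s') := by
  simp only [setView, Config.mk.injEq, and_true, true_and]
  exact Function.update_comm hpq.symm _ _ _

end Config

/-- Of the arbitrary local states that the model allows after a crash, `Move` always picks
`I.initLocal p`. Hence `down` needs no data and a crash erases all local information. `SEQ_p` stays
at `k` because only invocations change it. -/
theorem Move.step {p : Fin n} {op : Op} {k : ℕ} {x y : B.Mem × View I.Local Ret}
    {lab : Label n Op Ret} (h : I.Move p op k x lab y) (C : I.Config) (hk : C.seq p = k) :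
    I.Step (C.setView p op x) lab (C.setView p op y) := by
  have upd : ∀ (s : Status Op I.Local) (y : B.Mem × View I.Local Ret),
      C.setView p op y =
        { mem := y.1, seq := C.seq, status := Function.update (Function.update C.status p s) p
            (y.2.toStatus op (I.initLocal p)) } := by
    intro s y; simp [Config.setView]
  cases h with
  | act m σ =>
    have hs : (C.setView p op (m, .run σ)).status p = .running op σ := by
      simp [Config.setView, View.toStatus]
    rw [upd (.running op σ) ((I.code p σ).effect m, _)]
    cases hc : I.code p σ with
    | read o next => exact Step.read _ p op σ hs o next hc
    | write o x next => exact Step.write _ p op σ hs o x next hc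
    | prim o f next => exact Step.prim _ p op σ hs o f next hc
    | ret r next => exact Step.respond _ p op σ hs r next hc
  | crash m σ =>
    rw [upd (.running op σ) (m, .down)]
    exact Step.crash _ p op σ (by simp [Config.setView, View.toStatus]) (I.initLocal p)
  | recover m =>
    rw [upd (.crashed op (I.initLocal p)) (m, .run _), ← hk]
    exact Step.recover _ p op (I.initLocal p) (by simp [Config.setView, View.toStatus])

/-! ### Reachable configurations and their histories -/

variable (I) in
/-- `C` is reached by an execution with steps in `K` whose history is `h`, apart from crash and
recovery steps. -/
def Visited (K : Label n Op Ret → Prop) (C : I.Config) (h : List (Event n Op Ret)) : Prop :=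
  ∃ l, I.Reaches l C ∧ (∀ x ∈ l, K x) ∧ History.removeCrashes (l.filterMap Label.toEvent?) = h

theorem Visited.mono {K K' : Label n Op Ret → Prop} {C : I.Config} {h : List (Event n Op Ret)}
    (hv : I.Visited K C h) (hK : ∀ x, K x → K' x) : I.Visited K' C h := by
  obtain ⟨l, h1, h2, h3⟩ := hv
  exact ⟨l, h1, fun x hx => hK x (h2 x hx), h3⟩

theorem Visited.step {K : Label n Op Ret → Prop} {C C' : I.Config} {h : List (Event n Op Ret)}
    {lab : Label n Op Ret} (hv : I.Visited K C h) (hs : I.Step C lab C') (hK : K lab) :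
    I.Visited K C' (h ++ lab.events) := by
  obtain ⟨l, h1, h2, rfl⟩ := hv
  refine ⟨l ++ [lab], .snoc _ _ _ _ h1 hs, ?_, ?_⟩
  · intro x hx
    rcases List.mem_append.1 hx with hx | hx
    · exact h2 x hx
    · obtain rfl := List.mem_singleton.1 hx
      exact hK
  · cases lab <;> simp [History.removeCrashes, Label.events, Label.toEvent?]

theorem Visited.move {K : Label n Op Ret → Prop} {C : I.Config} {h : List (Event n Op Ret)}
    {p : Fin n} {op : Op} {x y : B.Mem × View I.Local Ret} {lab : Label n Op Ret}
    (hv : I.Visited K (C.setView p op x) h) (hm : I.Move p op (C.seq p) x lab y) (hK : K lab) :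
    I.Visited K (C.setView p op y) (h ++ y.2.resp p op) := by
  rw [← hm.events_eq]
  exact hv.step (hm.step C rfl) hK

theorem Visited.solo {K : Label n Op Ret → Prop} {C : I.Config} {h : List (Event n Op Ret)}
    {p : Fin n} {op : Op} {x y : B.Mem × View I.Local Ret}
    (hK : ∀ lab, lab.NoCrash → K lab)
    (hxy : Relation.ReflTransGen (I.Solo p) x y)
    (hv : I.Visited K (C.setView p op x) (h ++ x.2.resp p op)) :
    I.Visited K (C.setView p op y) (h ++ y.2.resp p op) := by
  induction hxy with
  | refl => exact hv
  | @tail y z _ hyz ih =>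
    obtain ⟨m, s⟩ := y
    obtain ⟨σ, rfl, rfl⟩ := hyz
    have hm := Move.act (I := I) (p := p) (op := op) (k := C.seq p) m σ
    have := ih.move hm (hK _ (Instr.label_noCrash _ _ _))
    rwa [hm.resp_eq_nil, List.append_nil] at this

theorem Recoverable.linearizable {O : SeqObject.{u, v, w} Op Ret} (hI : I.Recoverable O)
    {K : Label n Op Ret → Prop} {C : I.Config} {h : List (Event n Op Ret)}
    (hv : I.Visited K C h) : History.Linearizable O h := by
  obtain ⟨l, h1, -, rfl⟩ := hv
  exact (hI l C h1).2

/-- A finite execution followed by infinitely many steps is an infinite execution. -/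
theorem Reaches.exists_execution {l : List (Label n Op Ret)} {C : I.Config} (hl : I.Reaches l C)
    (conf : ℕ → I.Config) (lab : ℕ → Label n Op Ret) (h0 : conf 0 = C)
    (hs : ∀ i, I.Step (conf i) (lab i) (conf (i + 1))) :
    ∃ E : I.Execution, (∀ i, E.conf (l.length + i) = conf i) ∧
      (∀ i, E.label (l.length + i) = lab i) ∧ ∀ t < l.length, E.label t ∈ l := by
  induction hl generalizing conf lab with
  | nil => exact ⟨⟨conf, lab, h0, hs⟩, by simp, by simp, by simp⟩
  | snoc l C s C' _ hstep ih =>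
    -- The last step of the finite execution is put in front of the infinite tail.
    obtain ⟨E, h1, h2, h3⟩ := ih (fun i => Nat.casesOn i C conf) (fun i => Nat.casesOn i s lab) rfl
      (fun i => by
        cases i with
        | zero => rw [← h0] at hstep; exact hstep
        | succ i => exact hs i)
    have e : ∀ i, (l ++ [s]).length + i = l.length + (i + 1) := by
      intro i; simp; omega
    refine ⟨E, fun i => by rw [e, h1], fun i => by rw [e, h2], fun t ht => ?_⟩
    rcases Nat.lt_succ_iff_lt_or_eq.1 (by simpa using ht) with h | rfl
    · exact List.mem_append_left _ (h3 t h)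
    · have := h2 0
      simp only [Nat.add_zero] at this
      rw [this]; simp

/-- A process that runs alone from some time on completes its operation, if the operation is
lock-free or if it terminates when it is executed alone. -/
theorem exists_done {S : Set Op} (hlf : I.LockFree S) (hta : I.TerminatesAlone Sᶜ)
    {K : Label n Op Ret → Prop} {C : I.Config} {h : List (Event n Op Ret)}
    (hv : I.Visited K C h) {p : Fin n} {op : Op} {σ : I.Local} (hs : C.status p = .running op σ)
    (hop : op ∈ S ∨ (∀ lab, K lab → lab.NoCrash) ∧ ∀ q, q ≠ p → ∃ σ, C.status q = .idle σ) :
    ∃ m r σ', Relation.ReflTransGen (I.Solo p) (C.mem, .run σ) (m, .done r σ') := by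
  by_contra hno
  push Not at hno
  -- If no response is ever reached, each solo step ends in a running state again, so the solo run
  -- can be continued forever.
  have next : ∀ x : {x : B.Mem × I.Local //
      Relation.ReflTransGen (I.Solo p) (C.mem, .run σ) (x.1, .run x.2)},
      ∃ y : {x : B.Mem × I.Local //
        Relation.ReflTransGen (I.Solo p) (C.mem, .run σ) (x.1, .run x.2)},
      ((I.code p x.1.2).effect x.1.1, (I.code p x.1.2).view x.1.1) = (y.1.1, .run y.1.2) := by
    rintro ⟨⟨m, τ⟩, hx⟩
    have hx' := hx.tail (c := ((I.code p τ).effect m, (I.code p τ).view m)) ⟨τ, rfl, rfl⟩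
    cases hw : (I.code p τ).view m with
    | run τ' => rw [hw] at hx'; exact ⟨⟨((I.code p τ).effect m, τ'), hx'⟩, rfl⟩
    | down => cases hc : I.code p τ <;> simp [hc, Instr.view] at hw
    | done r τ' => rw [hw] at hx'; exact absurd hx' (hno _ _ _)
  choose nx hnx using next
  let s := fun i => nx^[i] ⟨(C.mem, σ), .refl⟩
  let conf := fun i => C.setView p op ((s i).1.1, .run (s i).1.2)
  let lab := fun i => (I.code p (s i).1.2).label p op
  have hstep : ∀ i, I.Step (conf i) (lab i) (conf (i + 1)) := by
    intro i
    have := (Move.act (I := I) (p := p) (op := op) (k := C.seq p) (s i).1.1 (s i).1.2).step C rfl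
    rw [hnx] at this
    simpa only [conf, s, Function.iterate_succ_apply'] using this
  have hlab : ∀ i q op' r, lab i ≠ .event (.respond q op' r) := by
    intro i q op' r h
    have h1 := hnx (s i)
    cases hc : I.code p (s i).1.2 <;> simp [lab, hc, Instr.label, Instr.view] at h h1
  have hproc : ∀ i, (lab i).proc = p := fun i =>
    (Move.act (I := I) (p := p) (op := op) (k := C.seq p) (s i).1.1 (s i).1.2).proc_eq
  obtain ⟨l, hl, hlK, -⟩ := hv
  have h0 : conf 0 = C := Config.setView_self C p op _ hs
  obtain ⟨E, hE1, hE2, hE3⟩ := hl.exists_execution conf lab h0 hstep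
  have hT : E.conf l.length = C := by simpa [h0] using hE1 0
  have hlabT : ∀ t ≥ l.length, ∃ i, E.label t = lab i := fun t ht =>
    ⟨t - l.length, by rw [← hE2, Nat.add_sub_cancel' ht]⟩
  have hnores : ∀ t ≥ l.length, ∀ q op' r, E.label t ≠ .event (.respond q op' r) := by
    intro t ht q op' r
    obtain ⟨i, hi⟩ := hlabT t ht
    rw [hi]
    exact hlab i q op' r
  by_cases hS : op ∈ S
  · obtain ⟨t, ht, q, op', r, hr⟩ := hlf E {p} l.length
      (by rintro _ rfl; exact ⟨op, hS, σ, by rw [hT, hs]⟩)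
      (by
        intro t ht q hq
        obtain ⟨i, hi⟩ := hlabT t ht
        rw [hi]
        exact Instr.label_noCrash _ _ _ _)
      (by
        intro t ht
        obtain ⟨i, hi⟩ := hlabT t ht
        exact ⟨t, le_rfl, by rw [hi, hproc]; rfl⟩)
    exact hnores t ht _ _ _ hr
  · obtain ⟨hK, hidle⟩ := hop.resolve_left hS
    obtain ⟨t, ht, op', r, hr⟩ := hta E p l.length
      (by
        intro t q
        by_cases ht : t < l.length
        · exact hK _ (hlK _ (hE3 t ht)) q
        · obtain ⟨i, hi⟩ := hlabT t (by omega)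
          rw [hi]
          exact Instr.label_noCrash _ _ _ _)
      ⟨op, hS, σ, by rw [hT, hs]⟩ (by rw [hT]; exact hidle)
      (by
        intro t ht
        obtain ⟨i, hi⟩ := hlabT t ht
        rw [hi, hproc])
    exact hnores t ht _ _ _ hr

theorem Visited.invoke {K : Label n Op Ret → Prop} {C : I.Config} {h : List (Event n Op Ret)}
    (hv : I.Visited K C h) {p : Fin n} {σ : I.Local} (hs : C.status p = .idle σ) (op : Op)
    (hK : K (.event (.invoke p op))) :
    ∃ C', I.Visited K C' (h ++ [.invoke p op]) ∧ C'.mem = C.mem ∧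
      C'.status = Function.update C.status p (.running op (I.start p op (C.seq p + 1) σ)) ∧
      ∀ q, q ≠ p → C'.seq q = C.seq q :=
  ⟨_, hv.step (.invoke C p op σ hs) hK, rfl, rfl, fun _ hq => Function.update_of_ne hq _ _⟩

/-- A process can execute any list of operations alone. -/
theorem exists_base {S : Set Op} (hlf : I.LockFree S) (hta : I.TerminatesAlone Sᶜ) (p : Fin n)
    (base : List Op) :
    ∃ (A : List (Fin n × Op × Ret)) (C : I.Config),
      I.Visited Label.NoCrash C (History.sequential A) ∧ (∀ t ∈ A, t.1 = p) ∧
      A.map (·.2.1) = base ∧ ∀ q, ∃ σ, C.status q = .idle σ := by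
  induction base using List.reverseRecOn with
  | nil => exact ⟨[], I.initial, ⟨[], .nil, by simp, rfl⟩, by simp, rfl, fun q => ⟨_, rfl⟩⟩
  | append_singleton base op ih =>
    obtain ⟨A, C, hv, hA, rfl, hidle⟩ := ih
    obtain ⟨σ, hσ⟩ := hidle p
    obtain ⟨C', hv', -, hst, -⟩ := hv.invoke hσ op (by intro q; simp)
    generalize I.start p op (C.seq p + 1) σ = τ at hst
    have hp : C'.status p = .running op τ := by simp [hst]
    have hidle' : ∀ q, q ≠ p → ∃ σ, C'.status q = .idle σ := by
      intro q hq
      simpa [hst, hq] using hidle q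
    obtain ⟨m, r, σ', hrun⟩ := exists_done hlf hta hv' hp (.inr ⟨fun _ h => h, hidle'⟩)
    rw [← Config.setView_self C' p op (.run τ) hp] at hv'
    have hv'' := Visited.solo (fun _ h => h) hrun (by simpa [View.resp] using hv')
    refine ⟨A ++ [(p, op, r)], _, by simpa [View.resp] using hv'', ?_, by simp, ?_⟩
    · intro t ht
      rcases List.mem_append.1 ht with h | h
      · exact hA t h
      · simp_all
    · intro q
      by_cases hq : q = p
      · subst hq
        exact ⟨σ', by simp [Config.setView, View.toStatus]⟩
      · simpa [Config.setView, hq] using hidle' q hq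

end Implementation

/-! ### Two concurrent operations -/

namespace Implementation

variable {B : BaseSystem.{a, b, c, d}} {n : ℕ} {Op : Type u} {Ret : Type v}
  {I : Implementation.{u, v, a, b, c, d, e} B n Op Ret}

/-- Crashes, recoveries and returns ignore the memory. All other instructions leave the process
running, hence able to crash. A read belongs to the latter kind, with `t` the identity, since the
local state it produces depends on the memory. -/
theorem stepShape (hB : B.Interfering) (p : Fin n) (op : Op) (k : ℕ)
    (j : Instr B I.Local Ret) (x y : B.Mem × View I.Local Ret) (h : I.MoveTo p op k x y) :
    Valency.StepShape (I.MoveTo p op k) .down j.effect x y := by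
  obtain ⟨lab, h⟩ := h
  cases h with
  | crash m σ => exact .inl ⟨rfl, fun m => ⟨_, .crash m σ⟩⟩
  | recover m => exact .inl ⟨rfl, fun m => ⟨_, .recover m⟩⟩
  | act m σ =>
    by_cases hr : ∃ r next, I.code p σ = .ret r next
    · obtain ⟨r, next, hr⟩ := hr
      refine .inl ⟨by simp [hr, Instr.effect], fun m' => ?_⟩
      have := Move.act (I := I) (p := p) (op := op) (k := k) m' σ
      simp only [hr, Instr.effect, Instr.view] at this ⊢
      exact ⟨_, this⟩
    · have hv : ∀ m, ∃ σ', (I.code p σ).view m = .run σ' := by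
        intro m
        cases hc : I.code p σ with
        | ret r next => exact absurd ⟨r, next, hc⟩ hr
        | _ => exact ⟨_, rfl⟩
      refine .inr ⟨(I.code p σ).effect, rfl, fun m => ⟨_, .crash m σ⟩, ?_, ?_,
        fun m => ?_⟩
      · intro m'
        obtain ⟨σ', h'⟩ := hv m
        simp only [h']
        exact ⟨_, .crash m' σ'⟩
      · intro m'
        obtain ⟨σ', h'⟩ := hv m'
        refine ⟨_, ⟨_, .act m' σ⟩, ?_⟩
        rw [h']
        exact ⟨_, .crash _ σ'⟩
      · rcases Instr.interfere hB (I.code p σ) j m with h | h | h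
        · exact .inl h
        · exact .inr (.inl h)
        · exact .inr (.inr h)

theorem MoveTo.not_done {p : Fin n} {op : Op} {k : ℕ} {m : B.Mem} {r : Ret} {σ : I.Local}
    {y : B.Mem × View I.Local Ret} : ¬ I.MoveTo p op k (m, .done r σ) y := by
  rintro ⟨_, h⟩
  cases h

/-- The configuration in which `p` executes `op` and `q` executes `op'`. -/
def Config.joint (C : I.Config) (p q : Fin n) (op op' : Op)
    (G : B.Mem × View I.Local Ret × View I.Local Ret) : I.Config :=
  (C.setView q op' (G.1, G.2.2)).setView p op (G.1, G.2.1)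

/-- The joint steps of `p` and `q`, where `p` may crash. -/
abbrev JointStep (C : I.Config) (p q : Fin n) (op : Op) :
    B.Mem × View I.Local Ret × View I.Local Ret → B.Mem × View I.Local Ret × View I.Local Ret →
      Prop :=
  Valency.Joint (I.MoveTo p op (C.seq p)) (I.Solo q)

theorem Move.joint {C : I.Config} {p q : Fin n} {op : Op} (op' : Op) {m m' : B.Mem}
    {s s' : View I.Local Ret} (k : View I.Local Ret) {lab : Label n Op Ret}
    (h : I.Move p op (C.seq p) (m, s) lab (m', s')) :
    I.Step (C.joint p q op op' (m, s, k)) lab (C.joint p q op op' (m', s', k)) :=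
  h.step (C.setView q op' (m, k)) rfl

theorem Move.joint_right {C : I.Config} {p q : Fin n} (hpq : p ≠ q) (op : Op) {op' : Op}
    {m m' : B.Mem} (s : View I.Local Ret) {k k' : View I.Local Ret} {lab : Label n Op Ret}
    (h : I.Move q op' (C.seq q) (m, k) lab (m', k')) :
    I.Step (C.joint p q op op' (m, s, k)) lab (C.joint p q op op' (m', s, k')) := by
  have := h.step (C.setView p op (m, s)) rfl
  rw [← C.setView_comm hpq] at this
  have e : (C.setView p op (m, s)).setView q op' (m', k') =
      (C.setView p op (m', s)).setView q op' (m', k') := rfl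
  rw [e, ← C.setView_comm hpq] at this
  exact this

/-- The joint state `G` of `p` and `q` is reachable with a history that extends `h` by the
responses to `p` and `q`. -/
def JointVisited (C : I.Config) (p q : Fin n) (op op' : Op) (h : List (Event n Op Ret))
    (G : B.Mem × View I.Local Ret × View I.Local Ret) : Prop :=
  G.2.2 ≠ .down ∧ ∃ rs, I.Visited (fun _ => True) (C.joint p q op op' G) (h ++ rs) ∧
    rs.Perm (G.2.1.resp p op ++ G.2.2.resp q op')

/-! ### Joint runs: their histories, and the result once an operation has completed -/

section

variable {C : I.Config} {p q : Fin n} {op op' : Op} {h : List (Event n Op Ret)}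
  {G G' : B.Mem × View I.Local Ret × View I.Local Ret}

theorem JointVisited.step (hpq : p ≠ q) (hG : JointVisited C p q op op' h G)
    (hs : JointStep C p q op G G') : JointVisited C p q op op' h G' := by
  obtain ⟨hd, rs, hv, hp⟩ := hG
  cases hs with
  | left m s k m' s' hm =>
    obtain ⟨lab, hm⟩ := hm
    refine ⟨hd, rs ++ s'.resp p op, ?_, ?_⟩
    · have := hv.step (hm.joint op' k) trivial
      rwa [hm.events_eq, List.append_assoc] at this
    · have h1 := hm.resp_eq_nil
      simp only at h1 hp ⊢
      rw [h1, List.nil_append] at hp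
      exact (hp.append_right _).trans List.perm_append_comm
  | right m s k m' k' hm =>
    obtain ⟨σ, rfl, h2⟩ := hm
    obtain ⟨rfl, rfl⟩ := Prod.mk.inj h2
    have hm := Move.act (I := I) (p := q) (op := op') (k := C.seq q) m σ
    refine ⟨?_, rs ++ ((I.code q σ).view m).resp q op', ?_, ?_⟩
    · cases hc : I.code q σ <;> simp [Instr.view]
    · have := hv.step (hm.joint_right hpq op s) trivial
      rwa [hm.events_eq, List.append_assoc] at this
    · simp only [View.resp, List.append_nil] at hp
      exact hp.append_right _

theorem JointVisited.star (hpq : p ≠ q) (hG : JointVisited C p q op op' h G)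
    (hs : Relation.ReflTransGen (JointStep C p q op) G G') :
    JointVisited C p q op op' h G' := by
  induction hs with
  | refl => exact hG
  | tail _ hs ih => exact ih.step hpq hs

/-- Lock-freedom for the set `{p}`, applied after a recovery step if `p` is down. -/
theorem JointVisited.exists_result {S : Set Op} (hlf : I.LockFree S)
    (hta : I.TerminatesAlone Sᶜ) (hop : op ∈ S) (z : Ret)
    (hG : JointVisited C p q op op' h G) :
    ∃ y c, Relation.ReflTransGen (I.MoveTo p op (C.seq p)) (G.1, G.2.1) y ∧
      y.2.result z = some c := by
  obtain ⟨m, s, k⟩ := G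
  obtain ⟨-, rs, hv, -⟩ := hG
  have run : ∀ (m : B.Mem) (σ : I.Local) (h' : List (Event n Op Ret)),
      I.Visited (fun _ => True) (C.joint p q op op' (m, .run σ, k)) h' →
      ∃ y c, Relation.ReflTransGen (I.MoveTo p op (C.seq p)) (m, .run σ) y ∧
        y.2.result z = some c := by
    intro m σ h' hv'
    obtain ⟨m', r, σ', hr⟩ := exists_done hlf hta hv' (p := p) (op := op) (σ := σ)
      (by simp [Config.joint, Config.setView, View.toStatus]) (.inl hop)
    exact ⟨_, _, Solo.reflTransGen_moveTo op _ hr, rfl⟩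
  cases s with
  | done r σ => exact ⟨_, _, .refl, rfl⟩
  | run σ => exact run m σ _ hv
  | down =>
    have hm := Move.recover (I := I) (p := p) (op := op) (k := C.seq p) m
    obtain ⟨y, c, h1, h2⟩ := run _ _ _ (hv.step (hm.joint op' k) trivial)
    exact ⟨y, c, .head ⟨_, hm⟩ h1, h2⟩

theorem univalent_of_done_left {z r : Ret} {σ : I.Local} {m : B.Mem} {k : View I.Local Ret} :
    ∃ b, Valency.Univalent (I.MoveTo p op (C.seq p)) (I.Solo q) (View.result z)
      (m, .done r σ, k) b := by
  classical
  refine ⟨decide (r = z), fun G' hG' c hc => ?_⟩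
  have : G'.2.1 = .done r σ := by
    clear hc
    induction hG' with
    | refl => rfl
    | tail _ hs ih =>
      cases hs with
      | left m s k m' s' hm =>
        simp only at ih
        subst ih
        exact absurd hm MoveTo.not_done
      | right m s k m' k' hm => exact ih
  rw [this] at hc
  simpa [View.result] using hc.symm

/-- The response of `q` is final and `hz` makes the result of `p` its complement. -/
theorem univalent_of_done_right (hpq : p ≠ q) {z r' : Ret} {σ : I.Local} {m : B.Mem}
    {s : View I.Local Ret}
    (hz : ∀ m r σ r' σ', JointVisited C p q op op' h (m, .done r σ, .done r' σ') →
      (r = z ↔ r' ≠ z))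
    (hG : JointVisited C p q op op' h (m, s, .done r' σ)) :
    ∃ b, Valency.Univalent (I.MoveTo p op (C.seq p)) (I.Solo q) (View.result z)
      (m, s, .done r' σ) b := by
  classical
  refine ⟨decide (r' ≠ z), fun G' hG' c hc => ?_⟩
  have h1 : G'.2.2 = .done r' σ := by
    clear hc
    induction hG' with
    | refl => rfl
    | tail _ hs ih =>
      cases hs with
      | left m s k m' s' hm => exact ih
      | right m s k m' k' hm =>
        obtain ⟨τ, h1, -⟩ := hm
        simp only at ih h1
        rw [ih] at h1
        simp at h1
  have h2 := hG.star hpq hG'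
  obtain ⟨m', s', k'⟩ := G'
  simp only at h1 hc
  subst h1
  cases s' with
  | done r τ =>
    have := hz _ _ _ _ _ h2
    simp only [View.result, Option.some.injEq] at hc
    rw [← hc]
    simp [this]
  | _ => simp [View.result] at hc

end

/-- The result of `p` cannot be undecided while `q` has not completed its operation. -/
theorem exists_univalent_joint (hB : B.Interfering) {S : Set Op} (hlf : I.LockFree S)
    (hta : I.TerminatesAlone Sᶜ) {p q : Fin n} (hpq : p ≠ q) {op op' : Op} (hop : op ∈ S)
    (hop' : op' ∈ S) {C : I.Config} {h : List (Event n Op Ret)} (z : Ret)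
    (hz : ∀ m r σ r' σ', JointVisited C p q op op' h (m, .done r σ, .done r' σ') →
      (r = z ↔ r' ≠ z))
    {G : B.Mem × View I.Local Ret × View I.Local Ret} (hG : JointVisited C p q op op' h G) :
    ∃ b, Valency.Univalent (I.MoveTo p op (C.seq p)) (I.Solo q) (View.result z) G b := by
  by_contra hno
  let Undecided : B.Mem × View I.Local Ret × View I.Local Ret → Prop := fun G =>
    JointVisited C p q op op' h G ∧
      ¬ ∃ b, Valency.Univalent (I.MoveTo p op (C.seq p)) (I.Solo q) (View.result z) G b
  let D := Valency.Distance (I.MoveTo p op (C.seq p)) (I.Solo q) Undecided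
  have hrun : ∀ G, Undecided G → ∃ σ, G.2.2 = .run σ := by
    rintro ⟨m, s, k⟩ ⟨h1, h2⟩
    cases k with
    | run σ => exact ⟨σ, rfl⟩
    | down => exact absurd rfl h1.1
    | done r σ => exact absurd (univalent_of_done_right hpq hz h1) h2
  have hleft : ∀ G, Undecided G → G.2.1.resp p op = [] := by
    rintro ⟨m, s, k⟩ ⟨h1, h2⟩
    cases s with
    | done r σ => exact absurd univalent_of_done_left h2
    | _ => rfl
  have hD : ∀ G, Undecided G → ∃ N, D N G := by
    rintro ⟨m, s, k⟩ hU
    obtain ⟨σ, hσ⟩ := hrun _ hU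
    simp only at hσ
    subst hσ
    -- If no run of `p` leads to a place where the step of `q` keeps the bit open, that step decides
    -- everywhere, and the valency lemma decides the present state.
    by_contra hnD
    refine hU.2 (Valency.exists_univalent .down (I.code q σ).effect (I.code q σ).view (.run σ)
      (m, s) ?_ (stepShape hB p op (C.seq p) (I.code q σ)) ?_ ?_)
    · intro m y
      constructor
      · rintro ⟨τ, h1, h2⟩
        cases h1
        exact h2
      · rintro rfl
        exact ⟨σ, rfl, rfl⟩
    · intro G hG
      exact (hU.1.star hpq hG).exists_result hlf hta hop z
    · intro x hx
      by_contra hx'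
      have hs : I.Solo q (x.1, .run σ) ((I.code q σ).effect x.1, (I.code q σ).view x.1) :=
        ⟨σ, rfl, rfl⟩
      refine hnD (Valency.Distance.of_run hx hs ⟨?_, hx'⟩)
      exact (hU.1.star hpq (Valency.joint_of_solo (View.run σ) hx)).step hpq (.right _ _ _ _ _ hs)
  -- States are paired with the number of steps of `p` left before `q` moves. A step of `p` lowers
  -- this number; a step of `q` may reset it to anything.
  have next : ∀ t : {t : (B.Mem × View I.Local Ret × View I.Local Ret) × ℕ //
      Undecided t.1 ∧ D t.2 t.1},
      ∃ t' : {t : (B.Mem × View I.Local Ret × View I.Local Ret) × ℕ //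
        Undecided t.1 ∧ D t.2 t.1}, ∃ lab : Label n Op Ret,
      I.Step (C.joint p q op op' t.1.1) lab (C.joint p q op op' t'.1.1) ∧ lab.events = [] ∧
      lab ≠ .event (.crash q) ∧ (lab.proc = q ∨ t'.1.2 < t.1.2) := by
    rintro ⟨⟨G, N⟩, hU, hd⟩
    simp only at hU hd
    cases hd with
    | zero m s k m' k' h hS =>
      obtain ⟨N', hN'⟩ := hD _ hS
      obtain ⟨σ, h1, h2⟩ := h
      simp only at h1
      subst h1
      obtain ⟨rfl, rfl⟩ := Prod.mk.inj h2
      have hm := Move.act (I := I) (p := q) (op := op') (k := C.seq q) m σ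
      refine ⟨⟨(_, N'), hS, hN'⟩, _, hm.joint_right hpq op s, ?_, Instr.label_noCrash _ _ _ _,
        .inl hm.proc_eq⟩
      obtain ⟨τ, hτ⟩ := hrun _ hS
      simp only at hτ
      rw [hm.events_eq]
      simp only [hτ]
      rfl
    | succ N m s k m' s' h hd =>
      have hj : JointStep C p q op (m, s, k) (m', s', k) := .left _ _ _ _ _ h
      obtain ⟨lab, hm⟩ := h
      -- Univalence is inherited along runs, and an undecided state still lies ahead.
      have hU' : Undecided (m', s', k) := by
        refine ⟨hU.1.step hpq hj, ?_⟩
        rintro ⟨b, hb⟩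
        obtain ⟨G', h1, h2⟩ := hd.exists_mem
        exact h2.2 ⟨b, hb.mono h1⟩
      refine ⟨⟨(_, N), hU', hd⟩, lab, hm.joint op' k, ?_, ?_, .inr (Nat.lt_succ_self N)⟩
      · rw [hm.events_eq]; exact hleft _ hU'
      · rintro rfl
        exact hpq hm.proc_eq.symm
  choose nx lab hstep hev hcr hpr using next
  obtain ⟨N₀, hN₀⟩ := hD G ⟨hG, hno⟩
  let t := fun i => nx^[i] ⟨(G, N₀), ⟨hG, hno⟩, hN₀⟩
  have ht : ∀ i, t (i + 1) = nx (t i) := fun i => Function.iterate_succ_apply' _ _ _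
  obtain ⟨-, rs, ⟨l, hl, -, -⟩, -⟩ := id hG
  obtain ⟨E, hE1, hE2, -⟩ := hl.exists_execution (fun i => C.joint p q op op' (t i).1.1)
    (fun i => lab (t i)) rfl (fun i => by rw [ht]; exact hstep (t i))
  have hlabT : ∀ s ≥ l.length, ∃ i, E.label s = lab (t i) := fun s hs =>
    ⟨s - l.length, by rw [← hE2, Nat.add_sub_cancel' hs]⟩
  have hinf : ∀ N i, (t i).1.2 = N → ∃ j ≥ i, (lab (t j)).proc = q := by
    intro N
    induction N using Nat.strong_induction_on with
    | _ N ih =>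
      rintro i rfl
      rcases hpr (t i) with h1 | h1
      · exact ⟨i, le_rfl, h1⟩
      · rw [← ht] at h1
        obtain ⟨j, hj, hj'⟩ := ih _ h1 (i + 1) rfl
        exact ⟨j, by omega, hj'⟩
  -- Only `q` is in the set, so the crashes of `p` do not matter.
  obtain ⟨s, hs, q', op'', r, hr⟩ := hlf E {q} l.length
    (by
      rintro _ rfl
      obtain ⟨σ, hσ⟩ := hrun G ⟨hG, hno⟩
      refine ⟨op', hop', σ, ?_⟩
      have := hE1 0
      rw [Nat.add_zero] at this
      rw [this]
      have h0 : (t 0).1.1 = G := rfl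
      simp [Config.joint, Config.setView, h0, hσ, hpq.symm, View.toStatus])
    (by
      rintro s hs _ rfl
      obtain ⟨i, hi⟩ := hlabT s hs
      rw [hi]
      exact hcr _)
    (by
      intro s hs
      obtain ⟨j, hj, hj'⟩ := hinf _ (s - l.length) rfl
      exact ⟨l.length + j, by omega, by rw [hE2]; exact hj'⟩)
  obtain ⟨i, hi⟩ := hlabT s hs
  have := hev (t i)
  rw [← hi, hr] at this
  simp [Label.events, Label.toEvent?, History.removeCrashes, Event.isCrashFree] at this

/-- No recoverable implementation from interfering primitives has a lock-free distinguishable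
operation. -/
theorem not_lockFree {Val : Type f} (O : SeqObject.{u, v, w} Op Ret) (M : Val → Op)
    (hM : O.Distinguishable M) (hn : 2 ≤ n) (hB : B.Interfering) (hI : I.Recoverable O)
    (hta : I.TerminatesAlone (Set.range M)ᶜ) (hlf : I.LockFree (Set.range M)) : False := by
  obtain ⟨base, x, y, z, ⟨hx, hxy⟩, hy, hyx⟩ := hM
  obtain ⟨p, q, hpq⟩ : ∃ p q : Fin n, p ≠ q := ⟨⟨0, by omega⟩, ⟨1, by omega⟩, by simp⟩
  obtain ⟨A, C, hv, hA, rfl, hidle⟩ := exists_base hlf hta p base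
  obtain ⟨σp, hσp⟩ := hidle p
  obtain ⟨σq, hσq⟩ := hidle q
  have hv := hv.mono (K' := fun _ => True) (fun _ _ => trivial)
  obtain ⟨Cp, hvp, hmp, hstp, hsp⟩ := hv.invoke hσp (M x) trivial
  obtain ⟨Cq, hvq, hmq, hstq, -⟩ := hv.invoke hσq (M y) trivial
  have hσq' : Cp.status q = .idle σq := by simp [hstp, hpq.symm, hσq]
  obtain ⟨C₂, hv₂, hm₂, hst₂, -⟩ := hvp.invoke hσq' (M y) trivial
  -- The invocation by `p` leaves `SEQ_q` and the memory alone, so `q` starts `M y` exactly as it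
  -- does when `p` is idle, and both solo runs can be replayed in `C₂`.
  rw [hsp q hpq.symm] at hst₂
  rw [hmp] at hm₂
  generalize I.start p (M x) (C.seq p + 1) σp = τp at *
  generalize I.start q (M y) (C.seq q + 1) σq = τq at *
  have hCp : Cp.status p = .running (M x) τp := by simp [hstp]
  have hCq : Cq.status q = .running (M y) τq := by simp [hstq]
  have hC₂p : C₂.status p = .running (M x) τp := by simp [hst₂, hpq, hstp]
  have hC₂q : C₂.status q = .running (M y) τq := by simp [hst₂]
  -- the responses of the first operation to complete
  obtain ⟨mp, rp, σp', hrunp⟩ := exists_done hlf hta hvp hCp (.inl ⟨x, rfl⟩)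
  obtain ⟨mq, rq, σq', hrunq⟩ := exists_done hlf hta hvq hCq (.inl ⟨y, rfl⟩)
  have hrp : rp = z := by
    rw [← Config.setView_self Cp p (M x) (.run τp) hCp] at hvp
    have := hI.linearizable (Visited.solo (fun _ _ => trivial) hrunp
      (by simpa [View.resp] using hvp))
    rw [List.append_assoc] at this
    exact (this.response_same hA).trans hx
  have hrq : rq = z := by
    rw [← Config.setView_self Cq q (M y) (.run τq) hCq] at hvq
    have := hI.linearizable (Visited.solo (fun _ _ => trivial) hrunq
      (by simpa [View.resp] using hvq))
    rw [List.append_assoc] at this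
    exact (this.response_other hA hpq).trans hy
  rw [hmp] at hrunp
  rw [hmq] at hrunq
  rw [List.append_assoc] at hv₂
  have hG : JointVisited C₂ p q (M x) (M y)
      (History.sequential A ++ [Event.invoke p (M x), Event.invoke q (M y)])
      (C.mem, .run τp, .run τq) := by
    refine ⟨by simp, [], ?_, .refl _⟩
    rw [List.append_nil, ← hm₂, Config.joint, Config.setView_self C₂ q _ (.run τq) hC₂q,
      Config.setView_self C₂ p _ (.run τp) hC₂p]
    exact hv₂
  have hz : ∀ m r σ r' σ', JointVisited C₂ p q (M x) (M y)
      (History.sequential A ++ [Event.invoke p (M x), Event.invoke q (M y)])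
      (m, .done r σ, .done r' σ') → (r = z ↔ r' ≠ z) := by
    rintro m r σ r' σ' ⟨-, rs, hvis, hp⟩
    have hlin := hI.linearizable hvis
    rw [List.append_assoc] at hlin
    rcases hlin.response_pair hA hpq hp with ⟨h1, h2⟩ | ⟨h1, h2⟩
    · rw [← h1, ← h2]; exact iff_of_true hx hxy
    · rw [← h1, ← h2]; exact iff_of_false hyx (by simp [hy])
  obtain ⟨b, hb⟩ := exists_univalent_joint hB hlf hta hpq ⟨x, rfl⟩ ⟨y, rfl⟩ z hz hG
  have hrunp' : Relation.ReflTransGen (I.MoveTo p (M x) (C₂.seq p)) (C.mem, .run τp)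
      (mp, .done rp σp') :=
    Solo.reflTransGen_moveTo _ _ hrunp
  have hb₁ : true = b := hb _ (Valency.joint_of_solo (View.run τq) hrunp') _
    (by simp [View.result, hrp])
  -- The opposite outcome: `q` completes first and returns `z`, then `p` completes and must not
  -- return `z`.
  have hright : Relation.ReflTransGen (JointStep C₂ p q (M x)) (C.mem, .run τp, .run τq)
      (mq, .run τp, .done rq σq') :=
    Valency.joint_of_solo_right (View.run τp) hrunq
  have hG' := hG.star hpq hright
  obtain ⟨⟨m, s⟩, c, hrun, hc⟩ := hG'.exists_result hlf hta ⟨x, rfl⟩ z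
  have hend := hright.trans (Valency.joint_of_solo (View.done rq σq') hrun)
  have hb₂ := hb _ hend c hc
  cases s with
  | done r σ =>
    have h1 := (hz _ _ _ _ _ (hG.star hpq hend))
    simp only [View.result, Option.some.injEq] at hc
    rw [← hb₁, ← hc] at hb₂
    exact h1.1 (by simpa using hb₂) hrq
  | _ => simp [View.result] at hc

end Implementation

/-! ### The swap object and the main theorem -/

theorem swapBase_interfering {Obj : Type a} (St : Obj → Type b) : (swapBase St).Interfering :=
  fun _ _ _ _ => .inr (.inl rfl)

/-- Both operations swap in the same `x ≠ v₀`: the first one returns the initial value, the second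
one returns `x`. -/
theorem swapObject_distinguishable {V : Type u} [Nontrivial V] (v₀ : V) :
    (swapObject v₀).Distinguishable (id : V → V) := by
  obtain ⟨x, hx⟩ := exists_ne v₀
  exact ⟨[], x, x, v₀, ⟨rfl, hx⟩, rfl, hx⟩

theorem mainTheorem3 :
    -- no lock-free recoverable implementation of a distinguishable operation
    (∀ {Op : Type u} {Ret : Type v} {Val : Type f} (O : SeqObject.{u, v, w} Op Ret) (M : Val → Op)
        (n : ℕ) (B : BaseSystem.{a, b, c, d}),
      O.Distinguishable M → 2 ≤ n → B.Interfering →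
      ¬ ∃ I : Implementation.{u, v, a, b, c, d, e} B n Op Ret,
          I.Recoverable O ∧ I.TerminatesAlone (Set.range M)ᶜ ∧ I.LockFree (Set.range M)) ∧
    -- in particular, no lock-free recoverable self-implementation of swap
    (∀ {V : Type u} [Nontrivial V] (v₀ : V) (n : ℕ) {Obj : Type a} (St : Obj → Type b),
      2 ≤ n →
      ¬ ∃ I : Implementation.{u, u, a, b, b, b, e} (swapBase St) n V V,
          I.Recoverable (swapObject v₀) ∧ I.LockFree Set.univ) := by
  refine ⟨?_, ?_⟩
  · rintro Op Ret Val O M n B hM hn hB ⟨I, hI, hta, hlf⟩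
    exact Implementation.not_lockFree O M hM hn hB hI hta hlf
  · rintro V _ v₀ n Obj St hn ⟨I, hI, hlf⟩
    refine Implementation.not_lockFree (swapObject v₀) id (swapObject_distinguishable v₀) hn
      (swapBase_interfering St) hI ?_ (by simpa using hlf)
    -- Every operation of the swap object is a SWAP, so no other operation has to terminate alone.
    rintro E p T - ⟨op, hop, -⟩
    simp at hop
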